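/- Let $(\Omega,\mathcal F,P)$ be a probability space, $K=\mathbb R$ or $\mathbb C$, and let $L^0(\mathcal F,K)$ be the algebra of equivalence classes of $K$-valued random variables. Let $L^0_+(\mathcal F)$ be the set of classes of real random variables that are $\ge 0$ a.s., ordered by $\le$ a.s., and let $L^0_{++}(\mathcal F)$ be the set of those that are $>0$ a.s. on $\Omega$. For $A\in\mathcal F$, $\tilde I_A$ is the class of the indicator function of $A$; $\bigvee$ denotes suprema with respect to $\le$ in $L^0_+(\mathcal F)$ (with $\bigvee\emptyset=0$). A countable partition is a sequence $(A_n)$ of pairwise disjoint sets in $\mathcal F$ (possibly empty) with union $\Omega$. Let $(E,\mathcal P)$ be a random locally convex ($RLC$) module over $K$ with base $(\Omega,\mathcal F,P)$: $E$ is an $L^0(\mathcal F,K)$-module with null element $\theta$; $\mathcal P$ is a family of $L^0$-seminorms on $E$, i.e. of maps $\|\cdot\|:E\to L^0_+(\mathcal F)$ with $\|\xi x\|=|\xi|\,\|x\|$ and $\|x+y\|\le\|x\|+\|y\|$ for $\xi\in L^0(\mathcal F,K)$ and $x,y\in E$; and $\bigvee\{\|x\|:\|\cdot\|\in\mathcal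 P\}=0$ iff $x=\theta$. Any family $\mathcal P'$ of $L^0$-seminorms on an $L^0(\mathcal F,K)$-module induces a locally $L^0$-convex topology, translation invariant, with local base at $\theta$ formed by the sets $\{x:\|x\|_{\mathcal Q}\le\varepsilon\}$, where $\mathcal Q\subset\mathcal P'$ is finite, $\|x\|_{\mathcal Q}=\bigvee\{\|x\|:\|\cdot\|\in\mathcal Q\}$ and $\varepsilon\in L^0_{++}(\mathcal F)$. Let $\mathcal T_c$ be the topology so induced on $E$ by $\mathcal P$; $L^0(\mathcal F,K)$ carries the topology so induced by $|\cdot|$. Let $E^*_c$ be the $L^0(\mathcal F,K)$-module of continuous $L^0(\mathcal F,K)$-linear maps $(E,\mathcal T_c)\to L^0(\mathcal F,K)$. A set $G\subset E$ has the countable concatenation property if for every sequence $(x_n)$ in $G$ and every countable partition $(A_n)$ there is $x\in G$ with $\tilde I_{A_n}x=\tilde I_{A_n}x_n$ for all $n$. In an $L^0(\mathcal F,K)$-module, a set $B$ $L^0$-absorbs a set $A$ if there is $\xi\in L^0_{++}(\mathcal F)$ with $\eta A\subset B$ for all $\eta\in L^0(\mathcal F,K)$ with $|\eta|\le\xi$;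 $B$ is $L^0$-absorbent if it $L^0$-absorbs every point; $B$ is $L^0$-balanced if $\eta B\subset B$ whenever $|\eta|\le1$; $B$ is $L^0$-convex if $\xi x+(1-\xi)y\in B$ for all $x,y\in B$ and $\xi\in L^0_+(\mathcal F)$ with $\xi\le1$. An $L^0$-barrel of $(E,\mathcal T_c)$ is an $L^0$-balanced, $L^0$-absorbent, $L^0$-convex, $\mathcal T_c$-closed subset of $E$. $(E,\mathcal T_c)$ is $L^0$-pre-barreled if every $L^0$-barrel with the countable concatenation property is a $\mathcal T_c$-neighborhood of $\theta$. Let $\sigma_c(E^*_c,E)$ be the topology on $E^*_c$ induced by the $L^0$-seminorms $f\mapsto|f(x)|$, $x\in E$. A set $A\subset E^*_c$ is $\sigma_c(E^*_c,E)$-bounded if it is $L^0$-absorbed by every $\sigma_c(E^*_c,E)$-neighborhood of $0$. Let $\beta(E,E^*_c)$ be the topology on $E$ induced by the $L^0$-seminorms $\|x\|_A=\bigvee\{|f(x)|:f\in A\}$, where $A$ runs through all $\sigma_c(E^*_c,E)$-bounded subsets of $E^*_c$. **Theorem.** Suppose that $E$ has the countable concatenation property. Then $(E,\mathcal T_c)$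 is $L^0$-pre-barreled if and only if $\mathcal T_c=\beta(E,E^*_c)$. -/

import Mathlib

open MeasureTheory Set Filter Topology
open scoped NNReal

namespace RandomConvex

noncomputable section

/-! ### The algebra `L⁰(F, K)` and its positive parts -/

section Scalars

variable {Ω : Type*} [MeasurableSpace Ω]

/-- `L⁰(F, K)`: equivalence classes of `K`-valued random variables on `(Ω, F, μ)`. -/
abbrev L0 (𝕜 : Type*) [RCLike 𝕜] (μ : Measure Ω) : Type _ := Ω →ₘ[μ] 𝕜

/-- `L⁰₊(F)`: equivalence classes of nonnegative real random variables, with the almost sure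
order. -/
abbrev L0Pos (μ : Measure Ω) : Type _ := Ω →ₘ[μ] ℝ≥0

/-- The pointwise ring structure on `L⁰(F, K)`; its addition and multiplication are Mathlib's. -/
instance instCommRingL0 (𝕜 : Type*) [RCLike 𝕜] (μ : Measure Ω) : CommRing (L0 𝕜 μ) :=
  { AEEqFun.instAddCommGroup (α := Ω) (μ := μ) (γ := 𝕜),
    AEEqFun.instCommMonoid (α := Ω) (μ := μ) (γ := 𝕜) with
    zero_mul := fun a => by
      induction a using AEEqFun.induction_on with
      | H f hf =>
        rw [AEEqFun.zero_def, AEEqFun.mk_mul_mk]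
        exact AEEqFun.mk_eq_mk.2 (Eventually.of_forall fun x => by simp)
    mul_zero := fun a => by
      induction a using AEEqFun.induction_on with
      | H f hf =>
        rw [AEEqFun.zero_def, AEEqFun.mk_mul_mk]
        exact AEEqFun.mk_eq_mk.2 (Eventually.of_forall fun x => by simp)
    left_distrib := fun a b c => by
      induction a, b, c using AEEqFun.induction_on₃ with
      | H f hf g hg h hh =>
        simp only [AEEqFun.mk_add_mk, AEEqFun.mk_mul_mk]
        exact AEEqFun.mk_eq_mk.2 (Eventually.of_forall fun x => by simp [mul_add])
    right_distrib := fun a b c => by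
      induction a, b, c using AEEqFun.induction_on₃ with
      | H f hf g hg h hh =>
        simp only [AEEqFun.mk_add_mk, AEEqFun.mk_mul_mk]
        exact AEEqFun.mk_eq_mk.2 (Eventually.of_forall fun x => by simp [add_mul]) }

/-- `0` is the least element of `L⁰₊(F)`. -/
instance instOrderBotL0Pos (μ : Measure Ω) : OrderBot (L0Pos μ) where
  bot := 0
  bot_le a := by
    rw [← AEEqFun.coeFn_le]
    filter_upwards [AEEqFun.coeFn_zero (α := Ω) (β := ℝ≥0) (μ := μ)] with ω h
    rw [h]
    exact bot_le

/-- `L⁰₊₊(F)`: the elements of `L⁰₊(F)` that are `> 0` almost surely on `Ω`. -/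
def L0PosPos (μ : Measure Ω) : Set (L0Pos μ) := {ε | ∀ᵐ ω ∂μ, 0 < ε ω}

/-- The modulus `|ξ| ∈ L⁰₊(F)` of `ξ ∈ L⁰(F, K)`. -/
def modulus {𝕜 : Type*} [RCLike 𝕜] {μ : Measure Ω} (ξ : L0 𝕜 μ) : L0Pos μ :=
  AEEqFun.comp (fun z : 𝕜 => ‖z‖₊) continuous_nnnorm ξ

/-- An element of `L⁰₊(F)` regarded as an element of `L⁰(F, K)`. -/
def toL0 (𝕜 : Type*) [RCLike 𝕜] {μ : Measure Ω} (ξ : L0Pos μ) : L0 𝕜 μ :=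
  AEEqFun.comp (fun r : ℝ≥0 => ((r : ℝ) : 𝕜))
    (RCLike.continuous_ofReal.comp NNReal.continuous_coe) ξ

/-- The equivalence class of the indicator function of a measurable set. -/
def indicatorL0 (𝕜 : Type*) [RCLike 𝕜] (μ : Measure Ω) (A : Set Ω) (hA : MeasurableSet A) :
    L0 𝕜 μ :=
  AEEqFun.mk (A.indicator fun _ => (1 : 𝕜)) (aestronglyMeasurable_const.indicator hA)

/-- The supremum `⋁ S` in the conditionally complete lattice `L⁰₊(F)`. The supremum of the empty
set is `0`; sets that are not bounded above get the value `0` by convention. -/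
def lsup {μ : Measure Ω} (S : Set (L0Pos μ)) : L0Pos μ :=
  open Classical in if h : ∃ η, IsLUB S η then h.choose else 0

/-- A countable partition of `Ω` into measurable sets (some of which may be empty). -/
structure IsCountablePartition (A : ℕ → Set Ω) : Prop where
  measurableSet : ∀ n, MeasurableSet (A n)
  disjoint : Pairwise fun m n => Disjoint (A m) (A n)
  iUnion_eq : ⋃ n, A n = univ

end Scalars

/-! ### Subsets of `L⁰(F, K)`-modules -/

section Sets

variable {𝕜 : Type*} [RCLike 𝕜] {Ω : Type*} [MeasurableSpace Ω] {μ : Measure Ω}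
  {E : Type*} [AddCommGroup E] [Module (L0 𝕜 μ) E]

/-- `A` is `L⁰`-absorbed by `B`. -/
def L0Absorbs (𝕜 : Type*) [RCLike 𝕜] (μ : Measure Ω) [Module (L0 𝕜 μ) E] (B A : Set E) : Prop :=
  ∃ ξ ∈ L0PosPos μ, ∀ η : L0 𝕜 μ, modulus η ≤ ξ → ∀ x ∈ A, η • x ∈ B

/-- `B` is `L⁰`-absorbent: it `L⁰`-absorbs every element of the module. -/
def IsL0Absorbent (𝕜 : Type*) [RCLike 𝕜] (μ : Measure Ω) [Module (L0 𝕜 μ) E] (B : Set E) : Prop :=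
  ∀ x : E, L0Absorbs 𝕜 μ B {x}

/-- `B` is `L⁰`-convex. -/
def IsL0Convex (𝕜 : Type*) [RCLike 𝕜] (μ : Measure Ω) [Module (L0 𝕜 μ) E] (B : Set E) : Prop :=
  ∀ x ∈ B, ∀ y ∈ B, ∀ ξ : L0Pos μ, ξ ≤ 1 → toL0 𝕜 ξ • x + (1 - toL0 𝕜 ξ) • y ∈ B

/-- `B` is `L⁰`-balanced. -/
def IsL0Balanced (𝕜 : Type*) [RCLike 𝕜] (μ : Measure Ω) [Module (L0 𝕜 μ) E] (B : Set E) : Prop :=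
  ∀ η : L0 𝕜 μ, modulus η ≤ 1 → ∀ x ∈ B, η • x ∈ B

/-- The countable concatenation property of a subset `G`: every sequence in `G` can be
concatenated along every countable partition `(Aₙ)` of `Ω`, and the concatenation
`∑ₙ I_{Aₙ} xₙ`, that is, the `x` with `I_{Aₙ} x = I_{Aₙ} xₙ` for all `n`, is in `G`. -/
def HasCountableConcatenation (𝕜 : Type*) [RCLike 𝕜] (μ : Measure Ω) [Module (L0 𝕜 μ) E]
    (G : Set E) : Prop :=
  ∀ (A : ℕ → Set Ω) (hA : IsCountablePartition A) (u : ℕ → E), (∀ n, u n ∈ G) →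
    ∃ x ∈ G, ∀ n, indicatorL0 𝕜 μ (A n) (hA.measurableSet n) • x =
      indicatorL0 𝕜 μ (A n) (hA.measurableSet n) • u n

/-! ### `L⁰`-seminorms and the locally `L⁰`-convex topology -/

/-- `L⁰`-seminorms on an `L⁰(F, K)`-module. -/
structure IsL0Seminorm (𝕜 : Type*) [RCLike 𝕜] {μ : Measure Ω} [Module (L0 𝕜 μ) E]
    (p : E → L0Pos μ) : Prop where
  smul : ∀ (ξ : L0 𝕜 μ) (x : E), p (ξ • x) = modulus ξ * p x
  add_le : ∀ x y : E, p (x + y) ≤ p x + p y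

/-- `(E, P)` is a random locally convex module: `P` is a family of `L⁰`-seminorms on the
`L⁰(F, K)`-module `E`, and `⋁ {‖x‖ : ‖·‖ ∈ P} = 0` iff `x = 0`. -/
structure IsRLCModule (𝕜 : Type*) [RCLike 𝕜] {μ : Measure Ω} [Module (L0 𝕜 μ) E]
    (P : Set (E → L0Pos μ)) : Prop where
  seminorm : ∀ p ∈ P, IsL0Seminorm 𝕜 p
  separating : ∀ x : E, IsLUB ((fun p => p x) '' P) 0 ↔ x = 0

/-- `‖x‖_Q = ⋁ {‖x‖ : ‖·‖ ∈ Q}` for a finite set `Q` of `L⁰`-seminorms. -/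
def supSeminorm {μ : Measure Ω} (Q : Finset (E → L0Pos μ)) (x : E) : L0Pos μ :=
  Q.sup fun p => p x

/-- The locally `L⁰`-convex topology `T_c` induced by a family `P` of `L⁰`-seminorms: a set `G` is
open iff for each `x ∈ G` it contains some `x + N(Q, ε)`, where
`N(Q, ε) = {y : ‖y‖_Q ≤ ε}`, `Q ⊆ P` is finite and `ε ∈ L⁰₊₊(F)`. -/
@[reducible] def locallyL0ConvexTopology {μ : Measure Ω} (P : Set (E → L0Pos μ)) : TopologicalSpace E where
  IsOpen G := ∀ x ∈ G, ∃ Q : Finset (E → L0Pos μ), ↑Q ⊆ P ∧ ∃ ε ∈ L0PosPos μ,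
    ∀ y, supSeminorm Q y ≤ ε → x + y ∈ G
  isOpen_univ := fun x _ => ⟨∅, by simp, 1, by
    filter_upwards [AEEqFun.coeFn_one (α := Ω) (β := ℝ≥0) (μ := μ)] with ω h
    rw [h]; exact zero_lt_one, fun _ _ => mem_univ _⟩
  isOpen_inter := fun s t hs ht x hx => by
    classical
    obtain ⟨Q, hQ, ε, hε, h⟩ := hs x hx.1
    obtain ⟨Q', hQ', ε', hε', h'⟩ := ht x hx.2
    refine ⟨Q ∪ Q', by simp [hQ, hQ'], ε ⊓ ε', ?_, fun y hy => ?_⟩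
    · filter_upwards [hε, hε', AEEqFun.coeFn_inf ε ε'] with ω h1 h2 h3
      rw [h3]; exact lt_inf_iff.2 ⟨h1, h2⟩
    · rw [supSeminorm, Finset.sup_union, sup_le_iff] at hy
      exact ⟨h y (hy.1.trans inf_le_left), h' y (hy.2.trans inf_le_right)⟩
  isOpen_sUnion := fun S hS x hx => by
    obtain ⟨s, hs, hxs⟩ := hx
    obtain ⟨Q, hQ, ε, hε, h⟩ := hS s hs x hxs
    exact ⟨Q, hQ, ε, hε, fun y hy => mem_sUnion.2 ⟨s, hs, h y hy⟩⟩

/-- The topology `T_c` of `L⁰(F, K)`, induced by the `L⁰`-norm `|·|`. -/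
@[reducible] def scalarTopology (𝕜 : Type*) [RCLike 𝕜] (μ : Measure Ω) : TopologicalSpace (L0 𝕜 μ) :=
  locallyL0ConvexTopology {(modulus : L0 𝕜 μ → L0Pos μ)}

/-- An `L⁰`-barrel of `(E, T)`: an `L⁰`-balanced, `L⁰`-absorbent, `L⁰`-convex, closed set. -/
structure IsL0Barrel (𝕜 : Type*) [RCLike 𝕜] (μ : Measure Ω) [Module (L0 𝕜 μ) E]
    (T : TopologicalSpace E) (B : Set E) : Prop where
  balanced : IsL0Balanced 𝕜 μ B
  absorbent : IsL0Absorbent 𝕜 μ B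
  convex : IsL0Convex 𝕜 μ B
  closed : IsClosed[T] B

/-- `(E, T)` is `L⁰`-pre-barreled: every `L⁰`-barrel with the countable concatenation property is
a neighborhood of `0`. -/
def IsL0PreBarreled (𝕜 : Type*) [RCLike 𝕜] (μ : Measure Ω) [Module (L0 𝕜 μ) E]
    (T : TopologicalSpace E) : Prop :=
  ∀ B : Set E, IsL0Barrel 𝕜 μ T B → HasCountableConcatenation 𝕜 μ B → B ∈ @nhds E T 0

/-- `A` is `T`-bounded: it is `L⁰`-absorbed by every `T`-neighborhood of `0`. -/
def IsL0Bounded (𝕜 : Type*) [RCLike 𝕜] (μ : Measure Ω) [Module (L0 𝕜 μ) E]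
    (T : TopologicalSpace E) (A : Set E) : Prop :=
  ∀ U ∈ @nhds E T 0, L0Absorbs 𝕜 μ U A

end Sets

/-! ### Helper facts: continuity of the module operations of `L⁰(F, K)` -/

section Helpers

variable {𝕜 : Type*} [RCLike 𝕜] {Ω : Type*} [MeasurableSpace Ω] {μ : Measure Ω}

theorem modulus_smul (ξ η : L0 𝕜 μ) : modulus (ξ • η) = modulus ξ * modulus η := by
  rw [smul_eq_mul]
  induction ξ, η using AEEqFun.induction_on₂ with
  | H f hf g hg =>
    simp only [modulus, AEEqFun.mk_mul_mk, AEEqFun.comp_mk]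
    exact AEEqFun.mk_eq_mk.2 (Eventually.of_forall fun x => by simp)

theorem modulus_add_le (ξ η : L0 𝕜 μ) : modulus (ξ + η) ≤ modulus ξ + modulus η := by
  induction ξ, η using AEEqFun.induction_on₂ with
  | H f hf g hg =>
    simp only [modulus, AEEqFun.mk_add_mk, AEEqFun.comp_mk]
    exact (AEEqFun.mk_le_mk _ _).2 (Eventually.of_forall fun x => nnnorm_add_le _ _)

theorem isL0Seminorm_modulus : IsL0Seminorm 𝕜 (modulus : L0 𝕜 μ → L0Pos μ) :=
  ⟨modulus_smul, modulus_add_le⟩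

theorem add_le_add_L0Pos {a b c d : L0Pos μ} (h : a ≤ b) (h' : c ≤ d) : a + c ≤ b + d := by
  rw [← AEEqFun.coeFn_le] at *
  filter_upwards [h, h', AEEqFun.coeFn_add a c, AEEqFun.coeFn_add b d] with ω h1 h2 h3 h4
  rw [h3, h4]
  exact add_le_add h1 h2

theorem exists_half {ε : L0Pos μ} (hε : ε ∈ L0PosPos μ) :
    ∃ δ ∈ L0PosPos μ, δ + δ ≤ ε := by
  refine ⟨(2⁻¹ : ℝ≥0) • ε, ?_, ?_⟩
  · filter_upwards [hε, AEEqFun.coeFn_smul (2⁻¹ : ℝ≥0) ε] with ω h1 h2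
    rw [h2]
    simpa using h1
  · rw [← add_smul]
    have : (2⁻¹ + 2⁻¹ : ℝ≥0) = 1 := by rw [← two_mul]; simp
    rw [this, one_smul]

theorem exists_mul_le {ε : L0Pos μ} (hε : ε ∈ L0PosPos μ) (c : L0Pos μ) :
    ∃ δ ∈ L0PosPos μ, ∀ a ≤ δ, c * a ≤ ε := by
  have hc : Continuous fun r : ℝ≥0 => (1 + r)⁻¹ :=
    (continuous_const.add continuous_id).inv₀ fun r => (add_pos_of_pos_of_nonneg zero_lt_one bot_le).ne'
  refine ⟨ε * AEEqFun.comp _ hc c, ?_, fun a ha => ?_⟩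
  · filter_upwards [hε, AEEqFun.coeFn_mul ε (AEEqFun.comp _ hc c), AEEqFun.coeFn_comp _ hc c]
      with ω h1 h2 h3
    rw [h2, Pi.mul_apply, h3]
    simp only [Function.comp_apply]
    positivity
  · rw [← AEEqFun.coeFn_le] at *
    filter_upwards [ha, AEEqFun.coeFn_mul ε (AEEqFun.comp _ hc c), AEEqFun.coeFn_comp _ hc c,
      AEEqFun.coeFn_mul c a] with ω h1 h2 h3 h4
    rw [h2, Pi.mul_apply, h3] at h1
    rw [h4, Pi.mul_apply]
    simp only [Function.comp_apply] at h1
    calc c ω * a ω ≤ (1 + c ω) * (ε ω * (1 + c ω)⁻¹) := by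
          gcongr
          exact le_add_of_nonneg_left zero_le_one
      _ = ε ω := by field_simp

theorem supSeminorm_add_le {E : Type*} [AddCommGroup E] [Module (L0 𝕜 μ) E]
    {P : Set (E → L0Pos μ)} (hP : ∀ p ∈ P, IsL0Seminorm 𝕜 p) {Q : Finset (E → L0Pos μ)}
    (hQ : ↑Q ⊆ P) (x y : E) : supSeminorm Q (x + y) ≤ supSeminorm Q x + supSeminorm Q y :=
  Finset.sup_le fun p hp => ((hP p (hQ hp)).add_le x y).trans
    (add_le_add_L0Pos (Finset.le_sup (f := fun p => p x) hp)
      (Finset.le_sup (f := fun p => p y) hp))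

theorem supSeminorm_zero {E : Type*} [AddCommGroup E] [Module (L0 𝕜 μ) E]
    {P : Set (E → L0Pos μ)} (hP : ∀ p ∈ P, IsL0Seminorm 𝕜 p) {Q : Finset (E → L0Pos μ)}
    (hQ : ↑Q ⊆ P) : supSeminorm Q (0 : E) ≤ ⊥ := by
  refine Finset.sup_le fun p hp => ?_
  have h := (hP p (hQ hp)).smul 0 0
  have h0 : modulus (0 : L0 𝕜 μ) = ⊥ := by
    change modulus (AEEqFun.mk _ _) = AEEqFun.mk _ _
    rw [modulus, AEEqFun.comp_mk]
    exact AEEqFun.mk_eq_mk.2 (Eventually.of_forall fun x => by simp)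
  rw [smul_zero, h0] at h
  rw [h, ← AEEqFun.coeFn_le]
  have hb : ((⊥ : L0Pos μ) : Ω → ℝ≥0) =ᵐ[μ] 0 := AEEqFun.coeFn_zero
  filter_upwards [AEEqFun.coeFn_mul (⊥ : L0Pos μ) (p 0), hb] with ω h1 h2
  rw [h1, Pi.mul_apply, h2]
  simp

/-- The sets `x + N(Q, ε)` form a local base at `x` of the topology induced by a family of
`L⁰`-seminorms. -/
theorem mem_nhds_iff_supSeminorm {E : Type*} [AddCommGroup E] [Module (L0 𝕜 μ) E]
    {P : Set (E → L0Pos μ)} (hP : ∀ p ∈ P, IsL0Seminorm 𝕜 p) (x : E) (U : Set E) :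
    U ∈ @nhds E (locallyL0ConvexTopology P) x ↔
      ∃ Q : Finset (E → L0Pos μ), ↑Q ⊆ P ∧ ∃ ε ∈ L0PosPos μ,
        ∀ y, supSeminorm Q y ≤ ε → x + y ∈ U := by
  let _ := locallyL0ConvexTopology P
  constructor
  · intro hU
    obtain ⟨V, hVU, hV, hx⟩ := mem_nhds_iff.1 hU
    obtain ⟨Q, hQ, ε, hε, h⟩ := hV x hx
    exact ⟨Q, hQ, ε, hε, fun y hy => hVU (h y hy)⟩
  · rintro ⟨Q, hQ, ε, hε, h⟩
    refine mem_nhds_iff.2 ⟨{z | ∃ Q : Finset (E → L0Pos μ), ↑Q ⊆ P ∧ ∃ ε ∈ L0PosPos μ,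
        ∀ y, supSeminorm Q y ≤ ε → z + y ∈ U}, ?_, ?_, ⟨Q, hQ, ε, hε, h⟩⟩
    · rintro z ⟨Q, hQ, ε, hε, h⟩
      simpa using h 0 ((supSeminorm_zero hP hQ).trans bot_le)
    · rintro z ⟨Q, hQ, ε, hε, h⟩
      obtain ⟨δ, hδ, hδε⟩ := exists_half hε
      refine ⟨Q, hQ, δ, hδ, fun y hy => ⟨Q, hQ, δ, hδ, fun y' hy' => ?_⟩⟩
      rw [add_assoc]
      exact h _ ((supSeminorm_add_le hP hQ y y').trans ((add_le_add_L0Pos hy hy').trans hδε))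

theorem mem_nhds_scalar_iff (ξ : L0 𝕜 μ) (U : Set (L0 𝕜 μ)) :
    U ∈ @nhds _ (scalarTopology 𝕜 μ) ξ ↔ ∃ ε ∈ L0PosPos μ, ∀ η, modulus η ≤ ε → ξ + η ∈ U := by
  classical
  rw [scalarTopology, mem_nhds_iff_supSeminorm (𝕜 := 𝕜)
    (fun p hp => by rw [mem_singleton_iff.1 hp]; exact isL0Seminorm_modulus)]
  constructor
  · rintro ⟨Q, hQ, ε, hε, h⟩
    refine ⟨ε, hε, fun η hη => h η (Finset.sup_le fun p hp => ?_)⟩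
    rw [mem_singleton_iff.1 (hQ hp)]
    exact hη
  · rintro ⟨ε, hε, h⟩
    exact ⟨{modulus}, by simp, ε, hε, fun η hη => h η (by simpa [supSeminorm] using hη)⟩

theorem continuous_scalar_iff {E : Type*} (T : TopologicalSpace E) (f : E → L0 𝕜 μ) :
    Continuous[T, scalarTopology 𝕜 μ] f ↔
      ∀ x, ∀ ε ∈ L0PosPos μ, ∀ᶠ y in @nhds E T x, modulus (f y - f x) ≤ ε := by
  let _ := scalarTopology 𝕜 μ
  rw [continuous_iff_continuousAt]
  refine forall_congr' fun x => ?_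
  constructor
  · intro h ε hε
    refine h ((mem_nhds_scalar_iff (f x) {ζ | modulus (ζ - f x) ≤ ε}).2 ⟨ε, hε, fun η hη => ?_⟩)
    simpa using hη
  · intro h U hU
    obtain ⟨ε, hε, hεU⟩ := (mem_nhds_scalar_iff (f x) U).1 hU
    refine mem_map.2 ?_
    filter_upwards [h ε hε] with y hy
    simpa using hεU _ hy

end Helpers

/-! ### Random conjugate space, random duality, and `β(X, Y)` -/

section Duality

variable {𝕜 : Type*} [RCLike 𝕜] {Ω : Type*} [MeasurableSpace Ω] {μ : Measure Ω}

/-- The random conjugate space `(E, T)*_c`: the `L⁰(F, K)`-module of continuous module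
homomorphisms from `(E, T)` to `(L⁰(F, K), T_c)`. -/
def randomConjugate (𝕜 : Type*) [RCLike 𝕜] (μ : Measure Ω) {E : Type*} [AddCommGroup E]
    [Module (L0 𝕜 μ) E] (T : TopologicalSpace E) : Submodule (L0 𝕜 μ) (E →ₗ[L0 𝕜 μ] L0 𝕜 μ) where
  carrier := {f | Continuous[T, scalarTopology 𝕜 μ] f}
  zero_mem' := by
    let _ := scalarTopology 𝕜 μ
    exact continuous_const (y := (0 : L0 𝕜 μ))
  add_mem' := fun {f g} hf hg => by
    refine (continuous_scalar_iff T _).2 fun x ε hε => ?_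
    obtain ⟨δ, hδ, hδε⟩ := exists_half hε
    filter_upwards [(continuous_scalar_iff T _).1 hf x δ hδ,
      (continuous_scalar_iff T _).1 hg x δ hδ] with y hy hy'
    have h : (f + g) y - (f + g) x = (f y - f x) + (g y - g x) := by
      simp only [LinearMap.add_apply]; ring
    rw [h]
    exact (modulus_add_le _ _).trans ((add_le_add_L0Pos hy hy').trans hδε)
  smul_mem' := fun c f hf => by
    refine (continuous_scalar_iff T _).2 fun x ε hε => ?_
    obtain ⟨δ, hδ, hδε⟩ := exists_mul_le hε (modulus c)
    filter_upwards [(continuous_scalar_iff T _).1 hf x δ hδ] with y hy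
    have h : (c • f) y - (c • f) x = c • (f y - f x) := by
      simp only [LinearMap.smul_apply, smul_sub]
    rw [h, modulus_smul]
    exact hδε _ hy

variable {X Y : Type*} [AddCommGroup X] [Module (L0 𝕜 μ) X] [AddCommGroup Y] [Module (L0 𝕜 μ) Y]

/-- The topology `σ_c(X, Y)` for an `L⁰`-bilinear pairing `⟨·, ·⟩` of `X` and `Y`: the locally
`L⁰`-convex topology on `X` induced by the `L⁰`-seminorms `|⟨·, y⟩|`, `y ∈ Y`. -/
@[reducible] def weakTopology (B : X →ₗ[L0 𝕜 μ] Y →ₗ[L0 𝕜 μ] L0 𝕜 μ) : TopologicalSpace X :=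
  locallyL0ConvexTopology (range fun (y : Y) (x : X) => modulus (B x y))

/-- `‖x‖_A = ⋁ {|⟨x, a⟩| : a ∈ A}` for `A ⊆ Y`. -/
def polarSeminorm (B : X →ₗ[L0 𝕜 μ] Y →ₗ[L0 𝕜 μ] L0 𝕜 μ) (A : Set Y) (x : X) : L0Pos μ :=
  lsup ((fun a => modulus (B x a)) '' A)

/-- The topology of random uniform convergence on the members of a family of subsets of `Y`. -/
@[reducible] def uniformConvergenceTopology (B : X →ₗ[L0 𝕜 μ] Y →ₗ[L0 𝕜 μ] L0 𝕜 μ) (𝒜 : Set (Set Y)) :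
    TopologicalSpace X :=
  locallyL0ConvexTopology (polarSeminorm B '' 𝒜)

/-- `β(X, Y)`: the topology of random uniform convergence on the family of all
`σ_c(Y, X)`-bounded subsets of `Y`. -/
@[reducible] def strongTopology (B : X →ₗ[L0 𝕜 μ] Y →ₗ[L0 𝕜 μ] L0 𝕜 μ) : TopologicalSpace X :=
  uniformConvergenceTopology B {A | IsL0Bounded 𝕜 μ (weakTopology B.flip) A}

/-- The natural pairing `⟨x, f⟩ = f x` of `E` and `(E, T)*_c`. -/
def naturalPairing (𝕜 : Type*) [RCLike 𝕜] (μ : Measure Ω) {E : Type*} [AddCommGroup E]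
    [Module (L0 𝕜 μ) E] (T : TopologicalSpace E) :
    E →ₗ[L0 𝕜 μ] randomConjugate 𝕜 μ T →ₗ[L0 𝕜 μ] L0 𝕜 μ :=
  (randomConjugate 𝕜 μ T).subtype.flip

end Duality

end

end RandomConvex

namespace RandomConvex

noncomputable section

/-! ### Essential infima of families of random variables -/

section EssentialInfimum

open scoped ENNReal

variable {Ω : Type*} [MeasurableSpace Ω] {μ : Measure Ω}

/-! The `σ_c(E*_c, E)`-bounded sets `A` are exactly the pointwise bounded ones, so every `‖·‖_A` is
a genuine `L⁰`-seminorm and the theorem compares two families of seminorms.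

The topology `β` is always finer than `T_c`: by Hahn–Banach each `p ∈ P` is the polar seminorm of
`{f : |f| ≤ p}`. If `E` is pre-barreled, `T_c` is also finer than `β`. Indeed the ball `{‖x‖_A ≤ ε}`
is closed, being cut out by the conditions `|f x| ≤ ε`, and it inherits countable concatenation from
`E` because seminorms are local; so it is a barrel of the required kind.

Conversely let `T_c = β` and let `B` be a barrel with countable concatenation. Its polar `A` is
pointwise bounded since `B` is absorbent, so it suffices that `{‖x‖_A ≤ 1/2} ⊆ B`. This is a bipolar
theorem, carried by `exists_linearMap_separating`. If `x₀ ∉ B`, closedness gives `s = ε⁻¹ ‖·‖_Q`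
with `s (x₀ - b) ≤ 1` for no `b ∈ B`. The infimal convolution `p x = ⋀ (t + s (x - t b))` of `s`
with the gauge of `B` is sublinear, at most `s` everywhere and at most `1` on `B`. It cannot be `<
1` almost surely at `x₀`: near-optimal `t`, `b` could then be glued by concatenation into one pair
with `t + s (x₀ - t b) ≤ 1`, although `t b ∈ B`. A functional with real part below `p` and equal to
it at `x₀` lies in the polar and violates `|g x₀| ≤ 1/2`.

Hahn–Banach itself rests on the order completeness of real `L⁰` (`exists_isGLB_and_seq`) and on
minimal sublinear maps being linear. Domination by an `L⁰`-seminorm then upgrades real linearity to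
`L⁰`-linearity. -/

/-- A family of measurable `[0, ∞]`-valued functions has a countable subfamily whose infimum is
almost surely below every member of the family. -/
theorem exists_seq_iInf_ae_le {ι : Type*} [Nonempty ι] (φ : ι → Ω → ℝ≥0∞)
    (hφ : ∀ i, AEMeasurable (φ i) μ) (hfin : ∀ i, ∫⁻ ω, φ i ω ∂μ ≠ ∞) :
    ∃ u : ℕ → ι, ∀ i, ∀ᵐ ω ∂μ, ⨅ n, φ (u n) ω ≤ φ i ω := by
  let m : (ℕ → ι) → ℝ≥0∞ := fun u => ∫⁻ ω, ⨅ n, φ (u n) ω ∂μ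
  have hmin : ∃ u, ∀ v, m u ≤ m v := by
    obtain ⟨a, -, ha, ha'⟩ := exists_seq_tendsto_sInf (range_nonempty m) (OrderBot.bddBelow _)
    choose v hv using ha'
    -- Merging a minimizing sequence of countable subfamilies into one countable subfamily attains
    -- the least integral.
    refine ⟨fun n => v n.unpair.1 n.unpair.2, fun w => ?_⟩
    refine le_trans ?_ (sInf_le (mem_range_self w))
    refine ge_of_tendsto' ha fun k => ?_
    rw [← hv k]
    refine lintegral_mono fun ω => le_iInf fun n => ?_
    refine (iInf_le _ (Nat.pair k n)).trans ?_
    simp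
  obtain ⟨u, hu⟩ := hmin
  refine ⟨u, fun i => ?_⟩
  -- Prepending `i` to the optimal `u` cannot lower the integral, so it does not lower the infimum
  -- off a null set.
  let v : ℕ → ι := fun n => Nat.casesOn n i u
  have hvu : ∀ ω, ⨅ n, φ (v n) ω ≤ ⨅ n, φ (u n) ω := fun ω =>
    le_iInf fun n => iInf_le (fun n => φ (v n) ω) (n + 1)
  have hvi : ∀ ω, ⨅ n, φ (v n) ω ≤ φ i ω := fun ω => iInf_le (fun n => φ (v n) ω) 0
  have h := ae_eq_of_ae_le_of_lintegral_le (μ := μ) (Eventually.of_forall hvu)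
    (ne_top_of_le_ne_top (hfin i) (lintegral_mono hvi)) (.iInf fun n => hφ _) (hu v)
  filter_upwards [h] with ω hω
  rw [← hω]
  exact hvi ω

/-- Every nonempty set of random variables which is bounded below has an essential infimum, and
this is the pointwise infimum of a sequence of members. -/
theorem exists_isGLB_and_seq [IsFiniteMeasure μ] {S : Set (Ω →ₘ[μ] ℝ)} (hS : S.Nonempty)
    (hb : BddBelow S) :
    ∃ g, IsGLB S g ∧ ∃ u : ℕ → Ω →ₘ[μ] ℝ, (∀ n, u n ∈ S) ∧
      ∀ᵐ ω ∂μ, IsGLB (range fun n => u n ω) (g ω) := by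
  have : Nonempty S := hS.to_subtype
  obtain ⟨b, hb⟩ := hb
  -- A strictly increasing map of the line into `(0, 4)`: it makes all integrals finite and
  -- preserves comparisons.
  let φ : ℝ → ℝ≥0∞ := fun x => ENNReal.ofReal (Real.arctan x + 2)
  have hpos : ∀ x, 0 < Real.arctan x + 2 := fun x => by
    linarith [Real.neg_pi_div_two_lt_arctan x, Real.pi_lt_four]
  have hφ : StrictMono φ := fun x y hxy =>
    (ENNReal.ofReal_lt_ofReal_iff (hpos y)).2 (by linarith [Real.arctan_strictMono hxy])
  have hφm : Measurable φ := hφ.monotone.measurable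
  have hφ4 : ∀ x, φ x ≤ 4 := fun x => by
    rw [show (4 : ℝ≥0∞) = ENNReal.ofReal 4 by simp]
    exact ENNReal.ofReal_le_ofReal (by linarith [Real.arctan_lt_pi_div_two x, Real.pi_lt_four])
  obtain ⟨u, hu⟩ := exists_seq_iInf_ae_le (μ := μ) (fun (a : S) ω => φ (a.1 ω))
    (fun a => hφm.comp_aemeasurable a.1.aestronglyMeasurable.aemeasurable) fun a =>
      ne_top_of_le_ne_top (b := ∫⁻ _, 4 ∂μ) (by
        rw [lintegral_const]; exact ENNReal.mul_ne_top (by simp) (measure_ne_top _ _))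
        (lintegral_mono fun ω => hφ4 _)
  have hbu : ∀ᵐ ω ∂μ, ∀ n, b ω ≤ (u n).1 ω :=
    ae_all_iff.2 fun n => AEEqFun.coeFn_le.2 (hb (u n).2)
  have hm : AEStronglyMeasurable (fun ω => ⨅ n, (u n).1 ω) μ :=
    (AEMeasurable.iInf fun n => (u n).1.aestronglyMeasurable.aemeasurable).aestronglyMeasurable
  have hg : ∀ᵐ ω ∂μ, IsGLB (range fun n => (u n).1 ω) (AEEqFun.mk _ hm ω) := by
    filter_upwards [hbu, AEEqFun.coeFn_mk _ hm] with ω h1 h2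
    rw [h2]
    exact isGLB_ciInf ⟨b ω, forall_mem_range.2 h1⟩
  refine ⟨AEEqFun.mk _ hm, ⟨fun a ha => ?_, fun c hc => ?_⟩, fun n => (u n).1, fun n => (u n).2, hg⟩
  · rw [← AEEqFun.coeFn_le]
    filter_upwards [hg, hu ⟨a, ha⟩] with ω h1 h2
    by_contra! h
    -- Strict monotonicity suffices: `a ω < g ω` gives `φ (a ω) < φ (g ω) ≤ φ (u n ω)` for all `n`.
    refine absurd h2 (not_le.2 ((hφ h).trans_le (le_iInf fun n => hφ.monotone ?_)))
    exact h1.1 (mem_range_self n)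
  · rw [← AEEqFun.coeFn_le]
    filter_upwards [hg, ae_all_iff.2 fun n => AEEqFun.coeFn_le.2 (hc (u n).2)] with ω h1 h2
    exact h1.2 (forall_mem_range.2 h2)

/-- `L⁰₊(F)` is conditionally complete. -/
theorem exists_isLUB_L0Pos [IsFiniteMeasure μ] {S : Set (L0Pos μ)} (hb : BddAbove S) :
    ∃ g, IsLUB S g := by
  rcases S.eq_empty_or_nonempty with rfl | hS
  · exact ⟨⊥, isLUB_empty⟩
  let n : L0Pos μ → Ω →ₘ[μ] ℝ := AEEqFun.comp (fun r : ℝ≥0 => -(r : ℝ)) (by fun_prop)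
  have hn : ∀ a : L0Pos μ, n a =ᵐ[μ] fun ω => -(a ω : ℝ) := AEEqFun.coeFn_comp _ _
  have hnle : ∀ a b : L0Pos μ, n a ≤ n b ↔ b ≤ a := fun a b => by
    rw [← AEEqFun.coeFn_le, ← AEEqFun.coeFn_le]
    refine eventually_congr ?_
    filter_upwards [hn a, hn b] with ω h1 h2
    rw [h1, h2, neg_le_neg_iff, NNReal.coe_le_coe]
  obtain ⟨b, hb⟩ := hb
  obtain ⟨g, hg, -⟩ := exists_isGLB_and_seq (hS.image n)
    ⟨n b, forall_mem_image.2 fun a ha => (hnle _ _).2 (hb ha)⟩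
  obtain ⟨a₀, ha₀⟩ := hS
  -- The truncation loses nothing, because `g ≤ n a₀ ≤ 0`.
  have hg0 : n (AEEqFun.comp (fun r : ℝ => (-r).toNNReal) (by fun_prop) g) = g := by
    refine AEEqFun.ext ?_
    filter_upwards [hn (AEEqFun.comp (fun r : ℝ => (-r).toNNReal) (by fun_prop) g),
      AEEqFun.coeFn_comp (fun r : ℝ => (-r).toNNReal) (by fun_prop) g,
      AEEqFun.coeFn_le.2 (hg.1 (mem_image_of_mem n ha₀)), hn a₀] with ω h1 h2 h3 h4
    rw [h1, h2, Function.comp_apply, Real.coe_toNNReal, neg_neg]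
    have : 0 ≤ (a₀ ω : ℝ) := NNReal.coe_nonneg _
    linarith
  refine ⟨AEEqFun.comp (fun r : ℝ => (-r).toNNReal) (by fun_prop) g, fun a ha => ?_,
    fun c hc => ?_⟩
  · rw [← hnle, hg0]
    exact hg.1 (mem_image_of_mem n ha)
  · rw [← hnle, hg0]
    exact hg.2 (forall_mem_image.2 fun a ha => (hnle _ _).2 (hc ha))

/-- Boundedness excludes the default value `0` of `lsup`. -/
theorem isLUB_lsup [IsFiniteMeasure μ] {S : Set (L0Pos μ)} (hb : BddAbove S) :
    IsLUB S (lsup S) := by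
  have h := exists_isLUB_L0Pos hb
  rw [lsup, dif_pos h]
  exact h.choose_spec

end EssentialInfimum

/-! ### The Hahn–Banach–Kantorovich theorem -/

section HahnBanach

/-- Sublinear maps from a real vector space to an ordered real vector space. -/
structure IsSublinear {V F : Type*} [AddCommGroup V] [Module ℝ V] [AddCommGroup F]
    [PartialOrder F] [Module ℝ F] (q : V → F) : Prop where
  add_le : ∀ x y, q (x + y) ≤ q x + q y
  smul : ∀ t : ℝ, 0 < t → ∀ x, q (t • x) = t • q x

/-- Moving one summand at a time across the inequality lets the two infima be taken independently.
This is the source of subadditivity for all the infima of sublinear maps below. -/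
theorem le_add_of_isGLB {F : Type*} [AddCommGroup F] [PartialOrder F] [IsOrderedAddMonoid F]
    {S T : Set F} {a b c : F} (ha : IsGLB S a) (hb : IsGLB T b)
    (h : ∀ s ∈ S, ∀ t ∈ T, c ≤ s + t) : c ≤ a + b := by
  rw [← sub_le_iff_le_add]
  refine ha.2 fun s hs => ?_
  rw [sub_le_comm]
  refine hb.2 fun t ht => ?_
  rw [sub_le_iff_le_add']
  exact h s hs t ht

variable {V F : Type*} [AddCommGroup V] [Module ℝ V] [AddCommGroup F] [PartialOrder F]
  [Module ℝ F]

/-- The reverse inequality is the given one for `t⁻¹` at the vector `t • x`. -/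
theorem smul_eq_of_le_smul [PosSMulMono ℝ F] {q : V → F}
    (h : ∀ t : ℝ, 0 < t → ∀ x, q (t • x) ≤ t • q x)
    (t : ℝ) (ht : 0 < t) (x : V) : q (t • x) = t • q x := by
  refine (h t ht x).antisymm ?_
  have := smul_le_smul_of_nonneg_left (h t⁻¹ (inv_pos.2 ht) (t • x)) ht.le
  rwa [smul_smul, smul_smul, inv_mul_cancel₀ ht.ne', mul_inv_cancel₀ ht.ne', one_smul,
    one_smul] at this

namespace IsSublinear

variable {q : V → F} (hq : IsSublinear q)
include hq

theorem map_zero : q 0 = 0 := by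
  have h := hq.smul 2 two_pos 0
  rw [smul_zero, two_smul] at h
  simpa using h

variable [IsOrderedAddMonoid F]

theorem neg_map_neg_le (x : V) : -q (-x) ≤ q x := by
  rw [neg_le_iff_add_nonneg, ← hq.map_zero]
  simpa using hq.add_le x (-x)

variable [PosSMulMono ℝ F]

/-- A sublinear map can be lowered to a sublinear map which is linear on the line through a
given vector. -/
theorem exists_le_neg (hF : ∀ S : Set F, S.Nonempty → BddBelow S → ∃ g, IsGLB S g) (y : V) :
    ∃ r : V → F, IsSublinear r ∧ r ≤ q ∧ r (-y) ≤ -q y := by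
  -- The lowered map is `r x = ⋀ (q (x + t y) - t q y)` over `t ≥ 0`. The value `t = 0` gives `r ≤
  -- q`, and `t = 1` at `-y` gives `r (-y) ≤ -q y`. The lower bound `-q (-x)` comes from `q (t y) ≤
  -- q (x + t y) + q (-x)`.
  have hex : ∀ x, ∃ g, IsGLB ((fun t : ℝ => q (x + t • y) - t • q y) '' Ici 0) g := fun x => by
    refine hF _ (nonempty_Ici.image _) ⟨-q (-x), forall_mem_image.2 fun t ht => ?_⟩
    rcases (mem_Ici.1 ht).eq_or_lt with rfl | ht
    · simpa using hq.neg_map_neg_le x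
    · rw [← hq.smul t ht, neg_le_sub_iff_le_add]
      simpa [add_comm] using hq.add_le (x + t • y) (-x)
  choose r hr using hex
  have hle : ∀ x, ∀ t : ℝ, 0 ≤ t → r x ≤ q (x + t • y) - t • q y := fun x t ht =>
    (hr x).1 (mem_image_of_mem _ ht)
  refine ⟨r, ⟨fun x x' => ?_, smul_eq_of_le_smul fun t ht x => ?_⟩, fun x => ?_, ?_⟩
  · refine le_add_of_isGLB (hr x) (hr x') (forall_mem_image.2 fun t ht =>
      forall_mem_image.2 fun t' ht' => (hle _ (t + t') (add_nonneg ht ht')).trans ?_)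
    have := hq.add_le (x + t • y) (x' + t' • y)
    rw [show x + x' + (t + t') • y = x + t • y + (x' + t' • y) by module]
    rw [show q (x + t • y) - t • q y + (q (x' + t' • y) - t' • q y) =
      q (x + t • y) + q (x' + t' • y) - (t + t') • q y by module]
    exact sub_le_sub_right this _
  · have h : t⁻¹ • r (t • x) ≤ r x := by
      refine (hr x).2 (forall_mem_image.2 fun s hs => ?_)
      have := smul_le_smul_of_nonneg_left (hle (t • x) (t * s) (mul_nonneg ht.le hs))
        (inv_pos.2 ht).le
      rwa [mul_smul, ← smul_add, hq.smul t ht, mul_smul, ← smul_sub, smul_smul,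
        inv_mul_cancel₀ ht.ne', one_smul] at this
    have := smul_le_smul_of_nonneg_left h ht.le
    rwa [smul_smul, mul_inv_cancel₀ ht.ne', one_smul] at this
  · simpa using hle x 0 le_rfl
  · simpa [hq.map_zero] using hle (-y) 1 zero_le_one

/-- Zorn's lemma in the reversed order: the pointwise infimum of a chain of sublinear maps is
sublinear. It exists because `-r₀ (-x)`, for any fixed member `r₀`, bounds the chain below at `x`.
-/
theorem exists_minimal (hF : ∀ S : Set F, S.Nonempty → BddBelow S → ∃ g, IsGLB S g) :
    ∃ r ≤ q, Minimal IsSublinear r := by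
  obtain ⟨m, hm, hm'⟩ := zorn_le_nonempty₀ (α := (V → F)ᵒᵈ)
    {r | IsSublinear (OrderDual.ofDual r) } (fun c hc hchain r₀ hr₀ => by
      have hex : ∀ x, ∃ g, IsGLB ((fun r : (V → F)ᵒᵈ => OrderDual.ofDual r x) '' c) g := fun x => by
        refine hF _ ⟨_, mem_image_of_mem _ hr₀⟩
          ⟨-OrderDual.ofDual r₀ (-x), forall_mem_image.2 fun r hr => ?_⟩
        rcases hchain.total hr hr₀ with h | h
        · exact ((hc hr₀).neg_map_neg_le x).trans (h x)
        · exact (neg_le_neg (h (-x))).trans ((hc hr).neg_map_neg_le x)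
      choose g hg using hex
      have hle : ∀ r ∈ c, ∀ x, g x ≤ OrderDual.ofDual r x := fun r hr x =>
        (hg x).1 (mem_image_of_mem _ hr)
      refine ⟨OrderDual.toDual g, ⟨fun x y => ?_, smul_eq_of_le_smul fun t ht x => ?_⟩,
        fun r hr x => hle r hr x⟩
      · refine le_add_of_isGLB (hg x) (hg y) (forall_mem_image.2 fun r hr =>
          forall_mem_image.2 fun r' hr' => ?_)
        -- Use the smaller of the two chain members for both summands.
        rcases hchain.total hr hr' with h | h
        · exact (hle r' hr' _).trans (((hc hr').add_le x y).trans (add_le_add_left (h x) _))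
        · exact (hle r hr _).trans (((hc hr).add_le x y).trans (add_le_add_right (h y) _))
      · have h : t⁻¹ • g (t • x) ≤ g x := by
          refine (hg x).2 (forall_mem_image.2 fun r hr => ?_)
          have := smul_le_smul_of_nonneg_left (hle r hr (t • x)) (inv_pos.2 ht).le
          rwa [(hc hr).smul t ht, smul_smul, inv_mul_cancel₀ ht.ne', one_smul] at this
        have := smul_le_smul_of_nonneg_left h ht.le
        rwa [smul_smul, mul_inv_cancel₀ ht.ne', one_smul] at this)
    (OrderDual.toDual q) hq
  exact ⟨OrderDual.ofDual m, hm, hm'.1, fun r hr hrm => hm'.2 (y := OrderDual.toDual r) hr hrm⟩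

/-- The Hahn–Banach–Kantorovich theorem: a sublinear map with values in a conditionally complete
ordered vector space dominates a linear map which agrees with it at a given vector. -/
theorem exists_linearMap_le (hF : ∀ S : Set F, S.Nonempty → BddBelow S → ∃ g, IsGLB S g)
    (x₀ : V) : ∃ f : V →ₗ[ℝ] F, (∀ x, f x ≤ q x) ∧ f x₀ = q x₀ := by
  -- Lowering `q` at `x₀` first forces `f (-x₀) ≤ -q x₀` for every `f ≤ r`, hence equality at `x₀`
  -- once `f` is odd.
  obtain ⟨r, hr, hrq, hr₀⟩ := hq.exists_le_neg hF x₀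
  obtain ⟨f, hfr, hf, hmin⟩ := hr.exists_minimal hF
  -- Lowering a minimal map along `y` changes nothing, so it is already odd; oddness and
  -- subadditivity give additivity.
  have hneg : ∀ y, f (-y) = -f y := fun y => by
    obtain ⟨s, hs, hsf, hsy⟩ := hf.exists_le_neg hF y
    refine le_antisymm ((hmin hs hsf (-y)).trans hsy) ?_
    simpa using neg_le_neg (hf.neg_map_neg_le y)
  have hadd : ∀ x y, f (x + y) = f x + f y := fun x y => by
    refine (hf.add_le x y).antisymm ?_
    have := hf.add_le (x + y) (-y)
    rwa [hneg, add_neg_cancel_right, ← sub_eq_add_neg, le_sub_iff_add_le] at this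
  refine ⟨{ toFun := f, map_add' := hadd, map_smul' := fun t x => ?_ },
    fun x => (hfr x).trans (hrq x), ((hfr x₀).trans (hrq x₀)).antisymm ?_⟩
  · rcases lt_trichotomy t 0 with ht | rfl | ht
    · have := hf.smul (-t) (neg_pos.2 ht) x
      rwa [neg_smul, neg_smul, hneg, neg_inj] at this
    · simp [hf.map_zero]
    · exact hf.smul t ht x
  · have := (hfr (-x₀)).trans hr₀
    rwa [hneg, neg_le_neg_iff] at this

end IsSublinear

end HahnBanach

/-! ### Pointwise descriptions of the operations of `L⁰` -/

section Pointwise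

variable {𝕜 : Type*} [RCLike 𝕜] {Ω : Type*} [MeasurableSpace Ω] {μ : Measure Ω}

instance instIsOrderedAddMonoidAEEqFunReal : IsOrderedAddMonoid (Ω →ₘ[μ] ℝ) where
  add_le_add_left a b h c := by
    rw [← AEEqFun.coeFn_le] at *
    filter_upwards [h, AEEqFun.coeFn_add a c, AEEqFun.coeFn_add b c] with ω h1 h2 h3
    rw [h2, h3]
    exact add_le_add_left h1 _

instance instPosSMulMonoAEEqFunReal : PosSMulMono ℝ (Ω →ₘ[μ] ℝ) where
  smul_le_smul_of_nonneg_left r hr a b h := by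
    rw [← AEEqFun.coeFn_le] at *
    filter_upwards [h, AEEqFun.coeFn_smul r a, AEEqFun.coeFn_smul r b] with ω h1 h2 h3
    rw [h2, h3]
    exact mul_le_mul_of_nonneg_left h1 hr

theorem coeFn_modulus (ξ : L0 𝕜 μ) : ∀ᵐ ω ∂μ, modulus ξ ω = ‖ξ ω‖₊ :=
  AEEqFun.coeFn_comp _ _ ξ

theorem coeFn_toL0 (ξ : L0Pos μ) : ∀ᵐ ω ∂μ, toL0 𝕜 ξ ω = ((ξ ω : ℝ) : 𝕜) :=
  AEEqFun.coeFn_comp _ _ ξ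

theorem coeFn_indicatorL0 {A : Set Ω} (hA : MeasurableSet A) :
    ∀ᵐ ω ∂μ, indicatorL0 𝕜 μ A hA ω = A.indicator (fun _ => 1) ω :=
  AEEqFun.coeFn_mk _ _

/-- A real random variable regarded as an element of `L⁰(F, K)`. -/
def ofRealL0 (𝕜 : Type*) [RCLike 𝕜] (ξ : Ω →ₘ[μ] ℝ) : L0 𝕜 μ :=
  AEEqFun.comp (fun r : ℝ => (r : 𝕜)) RCLike.continuous_ofReal ξ

theorem coeFn_ofRealL0 (ξ : Ω →ₘ[μ] ℝ) : ∀ᵐ ω ∂μ, ofRealL0 𝕜 ξ ω = (ξ ω : 𝕜) :=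
  AEEqFun.coeFn_comp _ _ ξ

/-- An element of `L⁰₊(F)` regarded as a real random variable. -/
def toRealL0 (ξ : L0Pos μ) : Ω →ₘ[μ] ℝ :=
  AEEqFun.comp (fun r : ℝ≥0 => (r : ℝ)) NNReal.continuous_coe ξ

theorem coeFn_toRealL0 (ξ : L0Pos μ) : ∀ᵐ ω ∂μ, toRealL0 ξ ω = (ξ ω : ℝ) :=
  AEEqFun.coeFn_comp _ _ ξ

/-- The embedding of the real numbers into `L⁰(F, K)` as constants. -/
def constL0 (𝕜 : Type*) [RCLike 𝕜] (μ : Measure Ω) : ℝ →+* L0 𝕜 μ where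
  toFun r := AEEqFun.const Ω (r : 𝕜)
  map_zero' := by simp; rfl
  map_one' := by simp; rfl
  map_add' r s := by simp only [RCLike.ofReal_add]; rfl
  map_mul' r s := by simp only [RCLike.ofReal_mul]; rfl

theorem coeFn_constL0 (r : ℝ) : ∀ᵐ ω ∂μ, constL0 𝕜 μ r ω = (r : 𝕜) :=
  AEEqFun.coeFn_const Ω (r : 𝕜)

theorem modulus_le_one_iff {ξ : L0 𝕜 μ} : modulus ξ ≤ 1 ↔ ∀ᵐ ω ∂μ, ‖ξ ω‖ ≤ 1 := by
  rw [← AEEqFun.coeFn_le]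
  refine eventually_congr ?_
  filter_upwards [coeFn_modulus ξ, AEEqFun.coeFn_one (α := Ω) (β := ℝ≥0) (μ := μ)] with ω h1 h2
  rw [h1, h2, Pi.one_apply, ← NNReal.coe_le_coe, coe_nnnorm, NNReal.coe_one]

/-- Every `ξ ∈ L⁰(F, K)` can be rotated to its modulus. -/
theorem exists_mul_eq_norm (ξ : L0 𝕜 μ) :
    ∃ η : L0 𝕜 μ, modulus η ≤ 1 ∧ ∀ᵐ ω ∂μ, η ω * ξ ω = ((‖ξ ω‖ : ℝ) : 𝕜) := by
  -- Where `ξ` vanishes the quotient is `0` by convention, which satisfies both requirements.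
  have hm : AEStronglyMeasurable (fun ω => star (ξ ω) / ((‖ξ ω‖ : ℝ) : 𝕜)) μ := by
    have h := ξ.aestronglyMeasurable.aemeasurable
    have h1 : AEMeasurable (fun ω => star (ξ ω)) μ := continuous_star.measurable.comp_aemeasurable h
    have h2 : AEMeasurable (fun ω => ((‖ξ ω‖ : ℝ) : 𝕜)) μ :=
      (RCLike.continuous_ofReal.comp continuous_norm).measurable.comp_aemeasurable h
    exact (h1.div h2).aestronglyMeasurable
  refine ⟨AEEqFun.mk _ hm, modulus_le_one_iff.2 ?_, ?_⟩
  · filter_upwards [AEEqFun.coeFn_mk _ hm] with ω h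
    rw [h, norm_div, norm_star, RCLike.norm_ofReal, abs_norm]
    exact div_self_le_one _
  · filter_upwards [AEEqFun.coeFn_mk _ hm] with ω h
    rw [h, div_mul_eq_mul_div, RCLike.star_def, RCLike.conj_mul]
    rcases eq_or_ne (ξ ω) 0 with h0 | h0
    · simp [h0]
    · rw [sq, mul_div_assoc, div_self (by simpa using h0), mul_one]

end Pointwise

/-! ### The Hahn–Banach theorem for `L⁰`-modules -/

section HahnBanach

variable {𝕜 : Type*} [RCLike 𝕜] {Ω : Type*} [MeasurableSpace Ω] {μ : Measure Ω}
  {E : Type*} [AddCommGroup E] [Module (L0 𝕜 μ) E]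

theorem IsL0Seminorm.map_neg {s : E → L0Pos μ} (hs : IsL0Seminorm 𝕜 s) (x : E) :
    s (-x) = s x := by
  have h := hs.smul (-1) x
  rw [neg_one_smul] at h
  rw [h]
  refine AEEqFun.ext ?_
  filter_upwards [AEEqFun.coeFn_mul (modulus (-1 : L0 𝕜 μ)) (s x), coeFn_modulus (-1 : L0 𝕜 μ),
    AEEqFun.coeFn_neg (1 : L0 𝕜 μ), AEEqFun.coeFn_one (α := Ω) (β := 𝕜) (μ := μ)] with ω h1 h2 h3 h4
  rw [h1, Pi.mul_apply, h2, h3, Pi.neg_apply, nnnorm_neg, h4]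
  simp

/-- A real-linear map dominated by an `L⁰`-seminorm is linear over the real random variables. -/
theorem map_ofRealL0_smul {s : E → L0Pos μ} (hs : IsL0Seminorm 𝕜 s) {f : E →+ (Ω →ₘ[μ] ℝ)}
    (hf : ∀ (r : ℝ) x, f (constL0 𝕜 μ r • x) = r • f x)
    (hfs : ∀ x, ∀ᵐ ω ∂μ, f x ω ≤ s x ω) (ξ : Ω →ₘ[μ] ℝ) (x : E) :
    ∀ᵐ ω ∂μ, f (ofRealL0 𝕜 ξ • x) ω = ξ ω * f x ω := by
  have habs : ∀ y, ∀ᵐ ω ∂μ, |f y ω| ≤ s y ω := fun y => by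
    have h := hfs (-y)
    rw [hs.map_neg, map_neg] at h
    filter_upwards [hfs y, h, AEEqFun.coeFn_neg (f y)] with ω h1 h2 h3
    rw [h3, Pi.neg_apply] at h2
    exact abs_le'.2 ⟨h1, h2⟩
  -- Apply the bound `|f| ≤ s` to `(ξ - q) x`. Rational constants keep the exceptional null sets
  -- countable; afterwards density permits the choice `r = ξ ω` at each remaining `ω`.
  have hq : ∀ q : ℚ, ∀ᵐ ω ∂μ,
      |f (ofRealL0 𝕜 ξ • x) ω - q * f x ω| ≤ |ξ ω - q| * s x ω := fun q => by
    have h := habs ((ofRealL0 𝕜 ξ - constL0 𝕜 μ q) • x)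
    rw [hs.smul, sub_smul, map_sub, hf] at h
    filter_upwards [h, AEEqFun.coeFn_sub (f (ofRealL0 𝕜 ξ • x)) ((q : ℝ) • f x),
      AEEqFun.coeFn_smul (q : ℝ) (f x),
      AEEqFun.coeFn_mul (modulus (ofRealL0 𝕜 ξ - constL0 𝕜 μ q)) (s x),
      coeFn_modulus (ofRealL0 𝕜 ξ - constL0 𝕜 μ q),
      AEEqFun.coeFn_sub (ofRealL0 𝕜 ξ) (constL0 𝕜 μ q), coeFn_ofRealL0 (𝕜 := 𝕜) ξ,
      coeFn_constL0 (𝕜 := 𝕜) (μ := μ) q] with ω h1 h2 h3 h4 h5 h6 h7 h8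
    rw [h2, Pi.sub_apply, h3, Pi.smul_apply, h4, Pi.mul_apply, h5, h6, Pi.sub_apply, h7, h8,
      NNReal.coe_mul, coe_nnnorm, ← RCLike.ofReal_sub, RCLike.norm_ofReal] at h1
    exact h1
  filter_upwards [ae_all_iff.2 hq] with ω h
  have hr : ∀ r : ℝ, |f (ofRealL0 𝕜 ξ • x) ω - r * f x ω| ≤ |ξ ω - r| * s x ω := fun r =>
    Rat.denseRange_cast.induction_on (p := fun r : ℝ =>
      |f (ofRealL0 𝕜 ξ • x) ω - r * f x ω| ≤ |ξ ω - r| * s x ω) r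
      (isClosed_le (by fun_prop) (by fun_prop)) h
  have := hr (ξ ω)
  rw [sub_self, abs_zero, zero_mul, abs_nonpos_iff, sub_eq_zero] at this
  exact this

/-- An additive map `f` with values in the real random variables which is linear over them is the
real part of the `L⁰(F, K)`-linear map `x ↦ f x - i f (i x)`. -/
theorem exists_linearMap_re_eq {f : E →+ (Ω →ₘ[μ] ℝ)}
    (hf : ∀ (ξ : Ω →ₘ[μ] ℝ) x, ∀ᵐ ω ∂μ, f (ofRealL0 𝕜 ξ • x) ω = ξ ω * f x ω) :
    ∃ g : E →ₗ[L0 𝕜 μ] L0 𝕜 μ, ∀ x, ∀ᵐ ω ∂μ, RCLike.re (g x ω) = f x ω := by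
  let I : L0 𝕜 μ := AEEqFun.const Ω RCLike.I
  have hI : ∀ᵐ ω ∂μ, I ω = RCLike.I := AEEqFun.coeFn_const Ω _
  let g : E → L0 𝕜 μ := fun x => ofRealL0 𝕜 (f x) - I * ofRealL0 𝕜 (f (I • x))
  have hg : ∀ x, ∀ᵐ ω ∂μ, g x ω = (f x ω : 𝕜) - RCLike.I * (f (I • x) ω : 𝕜) := fun x => by
    filter_upwards [hI, AEEqFun.coeFn_sub (ofRealL0 𝕜 (f x)) (I * ofRealL0 𝕜 (f (I • x))),
      AEEqFun.coeFn_mul I (ofRealL0 𝕜 (f (I • x))), coeFn_ofRealL0 (𝕜 := 𝕜) (f x),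
      coeFn_ofRealL0 (𝕜 := 𝕜) (f (I • x))] with ω h1 h2 h3 h4 h5
    rw [h2, Pi.sub_apply, h3, Pi.mul_apply, h1, h4, h5]
  have hfadd : ∀ x y, ∀ᵐ ω ∂μ, f (x + y) ω = f x ω + f y ω := fun x y => by
    rw [map_add]
    exact AEEqFun.coeFn_add _ _
  have hadd : ∀ x y, g (x + y) = g x + g y := fun x y => by
    refine AEEqFun.ext ?_
    filter_upwards [hg x, hg y, hg (x + y), AEEqFun.coeFn_add (g x) (g y), hfadd x y,
      hfadd (I • x) (I • y)] with ω h1 h2 h3 h4 h5 h6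
    rw [h4, Pi.add_apply, h1, h2, h3, h5, smul_add, h6]
    push_cast
    ring
  have hsmul : ∀ (ξ : L0 𝕜 μ) x, g (ξ • x) = ξ • g x := fun ξ x => by
    let a : Ω →ₘ[μ] ℝ := AEEqFun.comp _ RCLike.continuous_re ξ
    let b : Ω →ₘ[μ] ℝ := AEEqFun.comp _ RCLike.continuous_im ξ
    have ha : ∀ᵐ ω ∂μ, a ω = RCLike.re (ξ ω) := AEEqFun.coeFn_comp _ _ _
    have hb : ∀ᵐ ω ∂μ, b ω = RCLike.im (ξ ω) := AEEqFun.coeFn_comp _ _ _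
    have hξ : ξ = ofRealL0 𝕜 a + ofRealL0 𝕜 b * I := by
      refine AEEqFun.ext ?_
      filter_upwards [ha, hb, hI, AEEqFun.coeFn_add (ofRealL0 𝕜 a) (ofRealL0 𝕜 b * I),
        AEEqFun.coeFn_mul (ofRealL0 𝕜 b) I, coeFn_ofRealL0 (𝕜 := 𝕜) a,
        coeFn_ofRealL0 (𝕜 := 𝕜) b] with ω h1 h2 h3 h4 h5 h6 h7
      rw [h4, Pi.add_apply, h5, Pi.mul_apply, h6, h7, h1, h2, h3, RCLike.re_add_im]
    have hx : ∀ y : E, ξ • y = ofRealL0 𝕜 a • y + ofRealL0 𝕜 b • I • y := fun y => by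
      conv_lhs => rw [hξ]
      rw [add_smul, mul_smul]
    have hfξ : ∀ y, ∀ᵐ ω ∂μ, f (ξ • y) ω = a ω * f y ω + b ω * f (I • y) ω := fun y => by
      rw [hx y]
      filter_upwards [hfadd (ofRealL0 𝕜 a • y) (ofRealL0 𝕜 b • I • y), hf a y,
        hf b (I • y)] with ω h1 h2 h3
      rw [h1, h2, h3]
    refine AEEqFun.ext ?_
    have hξI := hfξ (I • x)
    rw [smul_comm] at hξI
    -- The real case has `I = 0`, the complex case `I * I = -1`.
    rcases RCLike.I_mul_I (K := 𝕜) with h0 | h0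
    · filter_upwards [ha, hb, hg x, hg (ξ • x), hfξ x, AEEqFun.coeFn_mul ξ (g x)]
        with ω h1 h2 h3 h4 h5 h6
      have him : RCLike.im (ξ ω) = 0 := RCLike.im_eq_zero h0 _
      rw [smul_eq_mul, h6, Pi.mul_apply, h4, h3, h5, h1, h2, h0, him]
      conv_rhs => rw [← RCLike.re_add_im (ξ ω), him]
      push_cast
      ring
    · have hII : I • I • x = -x := by
        rw [smul_smul, show I * I = -1 from ?_, neg_one_smul]
        change AEEqFun.const Ω (RCLike.I * RCLike.I) = _
        rw [h0]
        rfl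
      rw [hII, map_neg] at hξI
      filter_upwards [ha, hb, hg x, hg (ξ • x), hfξ x, AEEqFun.coeFn_mul ξ (g x), hξI,
        AEEqFun.coeFn_neg (f x)] with ω h1 h2 h3 h4 h5 h6 h7 h8
      rw [smul_eq_mul, h6, Pi.mul_apply, h4, h3, h5, h7, h8, h1, h2, Pi.neg_apply]
      conv_rhs => rw [← RCLike.re_add_im (ξ ω)]
      push_cast
      linear_combination (RCLike.im (ξ ω) : 𝕜) * (f (I • x) ω : 𝕜) * h0
  refine ⟨{ toFun := g, map_add' := hadd, map_smul' := hsmul }, fun x => ?_⟩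
  filter_upwards [hg x] with ω h
  change RCLike.re (g x ω) = _
  rw [h, map_sub, RCLike.re_mul_ofReal]
  simp

/-- The Hahn–Banach theorem for `L⁰`-modules: a real-sublinear map dominated by an `L⁰`-seminorm
`s` dominates the real part of an `L⁰(F, K)`-linear map which agrees with it at a given vector and
is dominated by `s`. -/
theorem exists_linearMap_re_le [IsFiniteMeasure μ] {s : E → L0Pos μ} (hs : IsL0Seminorm 𝕜 s)
    {p : E → Ω →ₘ[μ] ℝ} (hadd : ∀ x y, p (x + y) ≤ p x + p y)
    (hsmul : ∀ r : ℝ, 0 < r → ∀ x, p (constL0 𝕜 μ r • x) ≤ r • p x)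
    (hps : ∀ x, p x ≤ toRealL0 (s x)) (x₀ : E) :
    ∃ g : E →ₗ[L0 𝕜 μ] L0 𝕜 μ, (∀ x, ∀ᵐ ω ∂μ, RCLike.re (g x ω) ≤ p x ω) ∧
      (∀ᵐ ω ∂μ, RCLike.re (g x₀ ω) = p x₀ ω) ∧ ∀ x, modulus (g x) ≤ s x := by
  let _ : Module ℝ E := Module.compHom E (constL0 𝕜 μ)
  have hp : IsSublinear p := ⟨hadd, smul_eq_of_le_smul hsmul⟩
  obtain ⟨f, hfp, hf₀⟩ := hp.exists_linearMap_le
    (fun S hS hb => (exists_isGLB_and_seq hS hb).imp fun _ h => h.1) x₀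
  have hfs : ∀ x, ∀ᵐ ω ∂μ, f x ω ≤ s x ω := fun x => by
    filter_upwards [AEEqFun.coeFn_le.2 ((hfp x).trans (hps x)), coeFn_toRealL0 (s x)] with ω h1 h2
    rwa [h2] at h1
  obtain ⟨g, hg⟩ := exists_linearMap_re_eq (𝕜 := 𝕜) (f := f.toAddMonoidHom)
    (map_ofRealL0_smul hs (f := f.toAddMonoidHom) (fun r x => f.map_smul r x) hfs)
  have hg' : ∀ x, ∀ᵐ ω ∂μ, RCLike.re (g x ω) = f x ω := hg
  refine ⟨g, fun x => ?_, ?_, fun x => ?_⟩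
  · filter_upwards [hg' x, AEEqFun.coeFn_le.2 (hfp x)] with ω h1 h2
    rwa [h1]
  · rw [← hf₀]
    exact hg' x₀
  -- Rotating `x` by `η` makes `g` real and equal to `|g x|`, so the bound on real parts bounds the
  -- modulus.
  · obtain ⟨η, hη, hη'⟩ := exists_mul_eq_norm (g x)
    have h := hg' (η • x)
    rw [map_smul, smul_eq_mul] at h
    have h' := hfs (η • x)
    rw [hs.smul] at h'
    rw [← AEEqFun.coeFn_le]
    filter_upwards [hη', h, h', AEEqFun.coeFn_mul η (g x), coeFn_modulus (g x),
      AEEqFun.coeFn_mul (modulus η) (s x), coeFn_modulus η, modulus_le_one_iff.1 hη]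
      with ω h1 h2 h3 h4 h5 h6 h7 h8
    rw [h4, Pi.mul_apply, h1, RCLike.ofReal_re] at h2
    rw [← h2, h6, Pi.mul_apply, h7, NNReal.coe_mul, coe_nnnorm] at h3
    rw [h5, ← NNReal.coe_le_coe, coe_nnnorm]
    exact h3.trans (mul_le_of_le_one_left (NNReal.coe_nonneg _) h8)

end HahnBanach

/-! ### Arithmetic of `L⁰₊(F)` -/

section Arithmetic

variable {𝕜 : Type*} [RCLike 𝕜] {Ω : Type*} [MeasurableSpace Ω] {μ : Measure Ω}

theorem one_mem_L0PosPos : (1 : L0Pos μ) ∈ L0PosPos μ := by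
  filter_upwards [AEEqFun.coeFn_one (α := Ω) (β := ℝ≥0) (μ := μ)] with ω h
  rw [h]
  exact zero_lt_one

theorem mul_le_mul_L0Pos {a b c d : L0Pos μ} (h : a ≤ b) (h' : c ≤ d) : a * c ≤ b * d := by
  rw [← AEEqFun.coeFn_le] at *
  filter_upwards [h, h', AEEqFun.coeFn_mul a c, AEEqFun.coeFn_mul b d] with ω h1 h2 h3 h4
  rw [h3, h4]
  exact mul_le_mul' h1 h2

theorem exists_mul_eq_one {ε : L0Pos μ} (hε : ε ∈ L0PosPos μ) :
    ∃ c : L0Pos μ, ∀ᵐ ω ∂μ, c ω * ε ω = 1 := by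
  refine ⟨AEEqFun.mk (fun ω => (ε ω)⁻¹) ε.measurable.inv.aestronglyMeasurable, ?_⟩
  filter_upwards [hε, AEEqFun.coeFn_mk (fun ω => (ε ω)⁻¹)
    (ε.measurable.inv.aestronglyMeasurable (μ := μ))] with ω h1 h2
  rw [h2, inv_mul_cancel₀ h1.ne']

/-- `c` is the inverse of `ε`, so `c a ≤ 1` amounts to `a ≤ ε`. -/
theorem mul_le_one_iff_of_mul_eq_one {ε c : L0Pos μ} (hc : ∀ᵐ ω ∂μ, c ω * ε ω = 1)
    (a : L0Pos μ) : c * a ≤ 1 ↔ a ≤ ε := by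
  rw [← AEEqFun.coeFn_le, ← AEEqFun.coeFn_le]
  refine eventually_congr ?_
  filter_upwards [hc, AEEqFun.coeFn_mul c a, AEEqFun.coeFn_one (α := Ω) (β := ℝ≥0) (μ := μ)]
    with ω h1 h2 h3
  have h0 : 0 < c ω := pos_iff_ne_zero.2 fun h => by simp [h] at h1
  rw [h2, h3, Pi.mul_apply, Pi.one_apply, ← h1, mul_le_mul_iff_right₀ h0]

theorem modulus_toL0 (ξ : L0Pos μ) : modulus (toL0 𝕜 ξ) = ξ := by
  refine AEEqFun.ext ?_
  filter_upwards [coeFn_modulus (toL0 𝕜 ξ), coeFn_toL0 (𝕜 := 𝕜) ξ] with ω h1 h2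
  rw [h1, h2]
  simp

theorem modulus_zero : modulus (0 : L0 𝕜 μ) = 0 := by
  refine AEEqFun.ext ?_
  filter_upwards [coeFn_modulus (0 : L0 𝕜 μ), AEEqFun.coeFn_zero (α := Ω) (β := 𝕜) (μ := μ),
    AEEqFun.coeFn_zero (α := Ω) (β := ℝ≥0) (μ := μ)] with ω h1 h2 h3
  rw [h1, h3]
  refine (congrArg _ h2).trans ?_
  simp

theorem modulus_neg (ξ : L0 𝕜 μ) : modulus (-ξ) = modulus ξ :=
  isL0Seminorm_modulus.map_neg ξ

theorem L0Pos_zero_mul (a : L0Pos μ) : 0 * a = 0 := by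
  refine AEEqFun.ext ?_
  filter_upwards [AEEqFun.coeFn_mul 0 a, AEEqFun.coeFn_zero (α := Ω) (β := ℝ≥0) (μ := μ)]
    with ω h1 h2
  rw [h1, Pi.mul_apply, h2]
  simp

/-- An upper bound `c` of the multiples is divided by `k` where `k ≠ 0`. Where `k = 0` it says
nothing about `S`, and `g` itself is used instead. -/
theorem isLUB_mul {S : Set (L0Pos μ)} {g : L0Pos μ} (hg : IsLUB S g) (k : L0Pos μ) :
    IsLUB ((fun a => k * a) '' S) (k * g) := by
  refine ⟨forall_mem_image.2 fun a ha => mul_le_mul_L0Pos le_rfl (hg.1 ha), fun c hc => ?_⟩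
  have hm : Measurable fun ω => if k ω = 0 then g ω else c ω / k ω :=
    Measurable.ite (measurableSet_eq_fun k.measurable measurable_const) g.measurable
      (c.measurable.div k.measurable)
  have hd := AEEqFun.coeFn_mk (μ := μ) _ hm.aestronglyMeasurable
  have h : g ≤ AEEqFun.mk _ hm.aestronglyMeasurable := hg.2 fun a ha => by
    rw [← AEEqFun.coeFn_le]
    filter_upwards [hd, AEEqFun.coeFn_le.2 (hg.1 ha), AEEqFun.coeFn_mul k a,
      AEEqFun.coeFn_le.2 (hc (mem_image_of_mem _ ha))] with ω h1 h2 h3 h4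
    rw [h1]
    split_ifs with h0
    · exact h2
    · rw [h3, Pi.mul_apply] at h4
      rwa [le_div_iff₀' (pos_iff_ne_zero.2 h0)]
  rw [← AEEqFun.coeFn_le] at *
  filter_upwards [h, hd, AEEqFun.coeFn_mul k g] with ω h1 h2 h3
  rw [h2] at h1
  rw [h3, Pi.mul_apply]
  split_ifs at h1 with h0
  · simp [h0]
  · rwa [le_div_iff₀' (pos_iff_ne_zero.2 h0)] at h1

/-- Concatenation of a sequence in `L⁰₊(F)` along a countable partition. -/
theorem exists_concatenation_L0Pos {A : ℕ → Set Ω} (hA : IsCountablePartition A)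
    (u : ℕ → L0Pos μ) : ∃ t : L0Pos μ, ∀ᵐ ω ∂μ, ∀ n, ω ∈ A n → t ω = u n ω := by
  obtain ⟨f, hf, hfu⟩ := exists_measurable_piecewise A hA.measurableSet (fun n => ⇑(u n))
    (fun n => (u n).measurable) fun i j hij ω hω =>
      ((hA.disjoint hij).le_bot hω).elim
  refine ⟨AEEqFun.mk f hf.aestronglyMeasurable, ?_⟩
  filter_upwards [AEEqFun.coeFn_mk (μ := μ) f hf.aestronglyMeasurable] with ω h n hn
  rw [h]
  exact hfu n hn

/-- If almost every point lies in one of countably many measurable sets, these sets can be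
refined to a countable partition up to a null set. -/
theorem exists_isCountablePartition {D : ℕ → Set Ω} (hD : ∀ n, MeasurableSet (D n))
    (h : ∀ᵐ ω ∂μ, ∃ n, ω ∈ D n) :
    ∃ A, IsCountablePartition A ∧ ∀ᵐ ω ∂μ, ∀ n, ω ∈ A n → ω ∈ D n := by
  -- The uncovered null set is added so that the disjointed sets cover all of `Ω`, not merely almost
  -- all.
  have hD' : ∀ n, MeasurableSet (D n ∪ (⋃ k, D k)ᶜ) := fun n =>
    (hD n).union (MeasurableSet.iUnion hD).compl
  refine ⟨disjointed fun n => D n ∪ (⋃ k, D k)ᶜ, ⟨fun n => .disjointed hD' n,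
    disjoint_disjointed _, ?_⟩, ?_⟩
  · rw [iUnion_disjointed, ← iUnion_union, union_compl_self]
  · filter_upwards [h] with ω hω n hn
    exact (disjointed_subset _ _ hn).resolve_right fun h => h (mem_iUnion.2 hω)

end Arithmetic

/-! ### `L⁰`-seminorms and their balls -/

section Seminorm

variable {𝕜 : Type*} [RCLike 𝕜] {Ω : Type*} [MeasurableSpace Ω] {μ : Measure Ω}
  {E : Type*} [AddCommGroup E] [Module (L0 𝕜 μ) E]

theorem isLUB_supSeminorm {E : Type*} (Q : Finset (E → L0Pos μ)) (x : E) :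
    IsLUB ((fun p => p x) '' (Q : Set (E → L0Pos μ))) (supSeminorm Q x) :=
  ⟨forall_mem_image.2 fun _ hp => Finset.le_sup (f := fun p => p x) hp, fun _ hc =>
    Finset.sup_le fun _ hp => hc (mem_image_of_mem _ hp)⟩

theorem isL0Seminorm_supSeminorm {P : Set (E → L0Pos μ)} (hP : ∀ p ∈ P, IsL0Seminorm 𝕜 p)
    {Q : Finset (E → L0Pos μ)} (hQ : ↑Q ⊆ P) : IsL0Seminorm 𝕜 (supSeminorm Q) := by
  refine ⟨fun ξ x => ?_, supSeminorm_add_le hP hQ⟩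
  refine (isLUB_supSeminorm Q (ξ • x)).unique ?_
  have h := isLUB_mul (isLUB_supSeminorm Q x) (modulus ξ)
  rw [image_image] at h
  rwa [image_congr fun p hp => (hP p (hQ hp)).smul ξ x]

theorem IsL0Seminorm.map_zero {p : E → L0Pos μ} (hp : IsL0Seminorm 𝕜 p) : p 0 = 0 := by
  have h := hp.smul 0 0
  rwa [smul_zero, modulus_zero, L0Pos_zero_mul] at h

theorem IsL0Seminorm.const_mul {p : E → L0Pos μ} (hp : IsL0Seminorm 𝕜 p) (c : L0Pos μ) :
    IsL0Seminorm 𝕜 fun x => c * p x := by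
  refine ⟨fun ξ x => ?_, fun x y => ?_⟩
  · rw [hp.smul, mul_left_comm]
  · refine (mul_le_mul_L0Pos le_rfl (hp.add_le x y)).trans_eq (AEEqFun.ext ?_)
    filter_upwards [AEEqFun.coeFn_mul c (p x + p y), AEEqFun.coeFn_add (p x) (p y),
      AEEqFun.coeFn_add (c * p x) (c * p y), AEEqFun.coeFn_mul c (p x),
      AEEqFun.coeFn_mul c (p y)] with ω h1 h2 h3 h4 h5
    rw [h1, Pi.mul_apply, h2, h3, Pi.add_apply, Pi.add_apply, h4, h5]
    exact mul_add _ _ _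

theorem isL0Seminorm_modulus_comp (f : E →ₗ[L0 𝕜 μ] L0 𝕜 μ) :
    IsL0Seminorm 𝕜 fun x => modulus (f x) :=
  ⟨fun ξ x => by rw [map_smul, modulus_smul], fun x y => by rw [map_add]; exact modulus_add_le _ _⟩

/-- `L⁰`-seminorms are local. -/
theorem IsL0Seminorm.eq_on_of_indicatorL0_smul_eq {p : E → L0Pos μ} (hp : IsL0Seminorm 𝕜 p)
    {A : Set Ω} (hA : MeasurableSet A) {x y : E}
    (h : indicatorL0 𝕜 μ A hA • x = indicatorL0 𝕜 μ A hA • y) :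
    ∀ᵐ ω ∂μ, ω ∈ A → p x ω = p y ω := by
  have key : ∀ z, ∀ᵐ ω ∂μ, ω ∈ A → p (indicatorL0 𝕜 μ A hA • z) ω = p z ω := fun z => by
    rw [hp.smul]
    filter_upwards [AEEqFun.coeFn_mul (modulus (indicatorL0 𝕜 μ A hA)) (p z),
      coeFn_modulus (indicatorL0 𝕜 μ A hA), coeFn_indicatorL0 (𝕜 := 𝕜) (μ := μ) hA]
      with ω h1 h2 h3 hω
    rw [h1, Pi.mul_apply, h2, h3, indicator_of_mem hω, nnnorm_one, one_mul]
  filter_upwards [key x, key y] with ω h1 h2 hω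
  rw [← h1 hω, ← h2 hω, h]

variable {p : E → L0Pos μ} (hp : IsL0Seminorm 𝕜 p)
include hp

theorem IsL0Seminorm.isL0Balanced_ball (ε : L0Pos μ) : IsL0Balanced 𝕜 μ {x | p x ≤ ε} :=
  fun η hη x hx => by
    rw [mem_ofPred_eq, hp.smul]
    exact (mul_le_mul_L0Pos hη hx).trans_eq (one_mul ε)

theorem IsL0Seminorm.isL0Absorbent_ball {ε : L0Pos μ} (hε : ε ∈ L0PosPos μ) :
    IsL0Absorbent 𝕜 μ {x | p x ≤ ε} := fun x => by
  obtain ⟨δ, hδ, h⟩ := exists_mul_le hε (p x)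
  refine ⟨δ, hδ, fun η hη y hy => ?_⟩
  rw [mem_singleton_iff.1 hy, mem_ofPred_eq, hp.smul, mul_comm]
  exact h _ hη

theorem IsL0Seminorm.isL0Convex_ball (ε : L0Pos μ) : IsL0Convex 𝕜 μ {x | p x ≤ ε} :=
  fun x hx y hy ξ hξ => by
    refine (hp.add_le _ _).trans ?_
    rw [hp.smul, hp.smul, modulus_toL0]
    refine (add_le_add_L0Pos (mul_le_mul_L0Pos le_rfl hx) (mul_le_mul_L0Pos le_rfl hy)).trans ?_
    rw [← AEEqFun.coeFn_le] at *
    filter_upwards [hξ, AEEqFun.coeFn_one (α := Ω) (β := ℝ≥0) (μ := μ),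
      AEEqFun.coeFn_one (α := Ω) (β := 𝕜) (μ := μ),
      AEEqFun.coeFn_add (ξ * ε) (modulus (1 - toL0 𝕜 ξ) * ε), AEEqFun.coeFn_mul ξ ε,
      AEEqFun.coeFn_mul (modulus (1 - toL0 𝕜 ξ)) ε, coeFn_modulus (1 - toL0 𝕜 ξ),
      AEEqFun.coeFn_sub 1 (toL0 𝕜 ξ), coeFn_toL0 (𝕜 := 𝕜) ξ] with ω h1 h2 h3 h4 h5 h6 h7 h8 h9
    rw [h2, Pi.one_apply] at h1
    have h10 : ‖(1 - toL0 𝕜 ξ : L0 𝕜 μ) ω‖₊ = 1 - ξ ω := by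
      rw [← NNReal.coe_inj, coe_nnnorm, NNReal.coe_sub h1]
      refine (congrArg _ h8).trans ?_
      rw [Pi.sub_apply, h9]
      refine (congrArg (fun z : 𝕜 => ‖z - _‖) h3).trans ?_
      rw [Pi.one_apply, ← RCLike.ofReal_one, ← RCLike.ofReal_sub, RCLike.norm_ofReal, abs_of_nonneg,
        NNReal.coe_one]
      exact sub_nonneg.2 h1
    rw [h4, Pi.add_apply, h5, h6, Pi.mul_apply, Pi.mul_apply, h7, h10, ← add_mul,
      add_tsub_cancel_of_le h1, one_mul]

theorem IsL0Seminorm.hasCountableConcatenation_ball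
    (hE : HasCountableConcatenation 𝕜 μ (univ : Set E)) (ε : L0Pos μ) :
    HasCountableConcatenation 𝕜 μ {x | p x ≤ ε} := fun A hA u hu => by
  obtain ⟨x, -, hx⟩ := hE A hA u fun n => mem_univ _
  refine ⟨x, ?_, hx⟩
  rw [mem_ofPred_eq, ← AEEqFun.coeFn_le]
  filter_upwards [ae_all_iff.2 fun n => hp.eq_on_of_indicatorL0_smul_eq _ (hx n),
    ae_all_iff.2 fun n => AEEqFun.coeFn_le.2 (hu n)] with ω h1 h2
  obtain ⟨n, hn⟩ := mem_iUnion.1 (hA.iUnion_eq ▸ mem_univ ω)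
  rw [h1 n hn]
  exact h2 n

end Seminorm

/-! ### Topologies induced by families of `L⁰`-seminorms -/

section Topologies

variable {𝕜 : Type*} [RCLike 𝕜] {Ω : Type*} [MeasurableSpace Ω] {μ : Measure Ω}
  {E : Type*} [AddCommGroup E] [Module (L0 𝕜 μ) E] {P P' : Set (E → L0Pos μ)}

theorem locallyL0ConvexTopology_anti (h : P ⊆ P') :
    locallyL0ConvexTopology P' ≤ locallyL0ConvexTopology P := fun _ hG x hx => by
  obtain ⟨Q, hQ, ε, hε, hy⟩ := hG x hx
  exact ⟨Q, hQ.trans h, ε, hε, hy⟩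

/-- Single balls at the origin suffice: finite intersections produce the balls of `supSeminorm`, and
translation is built into the topology. -/
theorem locallyL0ConvexTopology_le (hP : ∀ p ∈ P, IsL0Seminorm 𝕜 p)
    (h : ∀ p ∈ P', ∀ ε ∈ L0PosPos μ, {x | p x ≤ ε} ∈ @nhds E (locallyL0ConvexTopology P) 0) :
    locallyL0ConvexTopology P ≤ locallyL0ConvexTopology P' := fun G hG x hx => by
  obtain ⟨Q, hQ, ε, hε, hy⟩ := hG x hx
  have hmem : {y | supSeminorm Q y ≤ ε} ∈ @nhds E (locallyL0ConvexTopology P) 0 := by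
    have := (Filter.biInter_finset_mem Q).2 fun p hp => h p (hQ hp) ε hε
    refine Filter.mem_of_superset this fun y hy => mem_ofPred_eq ▸ ?_
    exact Finset.sup_le fun p hp => mem_iInter₂.1 hy p hp
  obtain ⟨Q', hQ', ε', hε', h'⟩ := (mem_nhds_iff_supSeminorm hP 0 _).1 hmem
  exact ⟨Q', hQ', ε', hε', fun y hyQ => hy y (by simpa using h' y hyQ)⟩

theorem ball_mem_nhds (hP : ∀ p ∈ P, IsL0Seminorm 𝕜 p) {p : E → L0Pos μ} (hp : p ∈ P)
    {ε : L0Pos μ} (hε : ε ∈ L0PosPos μ) :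
    {x | p x ≤ ε} ∈ @nhds E (locallyL0ConvexTopology P) 0 :=
  (mem_nhds_iff_supSeminorm hP 0 _).2 ⟨{p}, by simpa using hp, ε, hε, fun y hy => by
    simpa [supSeminorm] using hy⟩

/-- The random factor `c` is needed because separation yields functionals bounded by `ε⁻¹ ‖·‖_Q`. -/
theorem mem_randomConjugate_of_modulus_le (hP : ∀ p ∈ P, IsL0Seminorm 𝕜 p)
    {Q : Finset (E → L0Pos μ)} (hQ : ↑Q ⊆ P) {c : L0Pos μ} {g : E →ₗ[L0 𝕜 μ] L0 𝕜 μ}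
    (hg : ∀ x, modulus (g x) ≤ c * supSeminorm Q x) :
    g ∈ randomConjugate 𝕜 μ (locallyL0ConvexTopology P) := by
  refine (continuous_scalar_iff _ _).2 fun x ε hε => ?_
  obtain ⟨δ, hδ, h⟩ := exists_mul_le hε c
  refine (mem_nhds_iff_supSeminorm hP x _).2 ⟨Q, hQ, δ, hδ, fun y hy => ?_⟩
  rw [mem_ofPred_eq, ← map_sub, add_sub_cancel_left]
  exact (hg y).trans (h _ hy)

end Topologies

/-! ### Polar seminorms -/

section Polar

variable {𝕜 : Type*} [RCLike 𝕜] {Ω : Type*} [MeasurableSpace Ω] {μ : Measure Ω}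
  {X Y : Type*} [AddCommGroup X] [Module (L0 𝕜 μ) X] [AddCommGroup Y] [Module (L0 𝕜 μ) Y]
  {B : X →ₗ[L0 𝕜 μ] Y →ₗ[L0 𝕜 μ] L0 𝕜 μ} {A : Set Y}

/-- A set is weakly `L⁰`-bounded iff it is pointwise bounded. -/
theorem isL0Bounded_weakTopology_flip_iff :
    IsL0Bounded 𝕜 μ (weakTopology B.flip) A ↔
      ∀ x, BddAbove ((fun a => modulus (B x a)) '' A) := by
  have hP : ∀ p ∈ range fun (x : X) (y : Y) => modulus (B.flip y x), IsL0Seminorm 𝕜 p :=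
    forall_mem_range.2 fun x => isL0Seminorm_modulus_comp (B x)
  constructor
  · intro h x
    obtain ⟨ξ, hξ, hξA⟩ := h _ (ball_mem_nhds hP (mem_range_self x) one_mem_L0PosPos)
    obtain ⟨c, hc⟩ := exists_mul_eq_one hξ
    refine ⟨c, forall_mem_image.2 fun a ha => ?_⟩
    -- Absorption tested at `η = ξ` gives `ξ |⟨x, a⟩| ≤ 1`, so `c = ξ⁻¹` is a common bound.
    have := hξA (toL0 𝕜 ξ) (modulus_toL0 ξ).le a ha
    rw [mem_ofPred_eq, B.flip_apply, map_smul, modulus_smul, modulus_toL0] at this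
    refine (mul_le_one_iff_of_mul_eq_one ?_ _).1 this
    simpa only [mul_comm] using hc
  · intro h U hU
    obtain ⟨Q, hQ, ε, hε, hU⟩ := (mem_nhds_iff_supSeminorm hP 0 _).1 hU
    choose c hc using h
    have hQ' : ∀ q ∈ Q, ∃ z, (fun y => modulus (B.flip y z)) = q := fun q hq => hQ hq
    choose! z hz using hQ'
    obtain ⟨δ, hδ, hδc⟩ := exists_mul_le hε (Q.sup fun q => c (z q))
    refine ⟨δ, hδ, fun η hη a ha => ?_⟩
    rw [← zero_add (η • a)]
    refine hU _ (Finset.sup_le fun q hq => ?_)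
    refine le_trans ?_ (hδc _ hη)
    rw [(hP q (hQ hq)).smul, mul_comm]
    refine mul_le_mul_L0Pos ?_ le_rfl
    refine le_trans ?_ (Finset.le_sup (f := fun q => c (z q)) hq)
    refine (congrFun (hz q hq) a).symm.trans_le ?_
    exact hc _ (mem_image_of_mem _ ha)

variable [IsFiniteMeasure μ] (hA : ∀ x, BddAbove ((fun a => modulus (B x a)) '' A))
include hA

theorem polarSeminorm_le_iff {x : X} {c : L0Pos μ} :
    polarSeminorm B A x ≤ c ↔ ∀ a ∈ A, modulus (B x a) ≤ c :=
  (isLUB_le_iff (isLUB_lsup (hA x))).trans forall_mem_image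

theorem modulus_le_polarSeminorm {a : Y} (ha : a ∈ A) (x : X) :
    modulus (B x a) ≤ polarSeminorm B A x :=
  (polarSeminorm_le_iff hA).1 le_rfl a ha

theorem isL0Seminorm_polarSeminorm : IsL0Seminorm 𝕜 (polarSeminorm B A) := by
  refine ⟨fun ξ x => ?_, fun x y => (polarSeminorm_le_iff hA).2 fun a ha => ?_⟩
  · refine (isLUB_lsup (hA (ξ • x))).unique ?_
    have h := isLUB_mul (isLUB_lsup (hA x)) (modulus ξ)
    rw [image_image] at h
    simp only [map_smul, LinearMap.smul_apply, modulus_smul]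
    exact h
  · rw [map_add, LinearMap.add_apply]
    exact (modulus_add_le _ _).trans (add_le_add_L0Pos (modulus_le_polarSeminorm hA ha x)
      (modulus_le_polarSeminorm hA ha y))

end Polar

/-! ### Separation of points from `L⁰`-convex sets -/

section Separation

variable {𝕜 : Type*} [RCLike 𝕜] {Ω : Type*} [MeasurableSpace Ω] {μ : Measure Ω}
  {E : Type*} [AddCommGroup E] [Module (L0 𝕜 μ) E]

theorem toRealL0_mono {a b : L0Pos μ} (h : a ≤ b) : toRealL0 a ≤ toRealL0 b := by
  rw [← AEEqFun.coeFn_le] at *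
  filter_upwards [h, coeFn_toRealL0 a, coeFn_toRealL0 b] with ω h1 h2 h3
  rw [h2, h3]
  exact_mod_cast h1

theorem toRealL0_add (a b : L0Pos μ) : toRealL0 (a + b) = toRealL0 a + toRealL0 b := by
  refine AEEqFun.ext ?_
  filter_upwards [coeFn_toRealL0 a, coeFn_toRealL0 b, coeFn_toRealL0 (a + b),
    AEEqFun.coeFn_add a b, AEEqFun.coeFn_add (toRealL0 a) (toRealL0 b)] with ω h1 h2 h3 h4 h5
  rw [h3, h4, h5, Pi.add_apply, Pi.add_apply, h1, h2, NNReal.coe_add]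

theorem toRealL0_nonneg (a : L0Pos μ) : 0 ≤ toRealL0 a := by
  rw [← AEEqFun.coeFn_le]
  filter_upwards [coeFn_toRealL0 a, AEEqFun.coeFn_zero (α := Ω) (β := ℝ) (μ := μ)] with ω h1 h2
  rw [h1, h2]
  exact NNReal.coe_nonneg _

theorem toL0_add (a b : L0Pos μ) : toL0 𝕜 (a + b) = toL0 𝕜 a + toL0 𝕜 b := by
  refine AEEqFun.ext ?_
  filter_upwards [coeFn_toL0 (𝕜 := 𝕜) a, coeFn_toL0 (𝕜 := 𝕜) b, coeFn_toL0 (𝕜 := 𝕜) (a + b),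
    AEEqFun.coeFn_add a b, AEEqFun.coeFn_add (toL0 𝕜 a) (toL0 𝕜 b)] with ω h1 h2 h3 h4 h5
  rw [h3, h4, h5, Pi.add_apply, Pi.add_apply, h1, h2]
  push_cast
  rfl

theorem toL0_mul (a b : L0Pos μ) : toL0 𝕜 (a * b) = toL0 𝕜 a * toL0 𝕜 b := by
  refine AEEqFun.ext ?_
  filter_upwards [coeFn_toL0 (𝕜 := 𝕜) a, coeFn_toL0 (𝕜 := 𝕜) b, coeFn_toL0 (𝕜 := 𝕜) (a * b),
    AEEqFun.coeFn_mul a b, AEEqFun.coeFn_mul (toL0 𝕜 a) (toL0 𝕜 b)] with ω h1 h2 h3 h4 h5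
  rw [h3, h4, h5, Pi.mul_apply, Pi.mul_apply, h1, h2]
  push_cast
  rfl

theorem toL0_one : toL0 𝕜 (1 : L0Pos μ) = 1 := by
  refine AEEqFun.ext ?_
  filter_upwards [coeFn_toL0 (𝕜 := 𝕜) (1 : L0Pos μ), AEEqFun.coeFn_one (α := Ω) (β := 𝕜) (μ := μ),
    AEEqFun.coeFn_one (α := Ω) (β := ℝ≥0) (μ := μ)] with ω h1 h2 h3
  rw [h1, h3]
  refine Eq.trans ?_ h2.symm
  simp

theorem toL0_smul {r : ℝ} (hr : 0 ≤ r) (a : L0Pos μ) :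
    toL0 𝕜 (r.toNNReal • a) = constL0 𝕜 μ r * toL0 𝕜 a := by
  refine AEEqFun.ext ?_
  filter_upwards [coeFn_toL0 (𝕜 := 𝕜) a, coeFn_toL0 (𝕜 := 𝕜) (r.toNNReal • a),
    AEEqFun.coeFn_smul r.toNNReal a, AEEqFun.coeFn_mul (constL0 𝕜 μ r) (toL0 𝕜 a),
    coeFn_constL0 (𝕜 := 𝕜) (μ := μ) r] with ω h1 h2 h3 h4 h5
  rw [h2, h3, h4, Pi.mul_apply, Pi.smul_apply, h1, h5, smul_eq_mul, NNReal.coe_mul,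
    Real.coe_toNNReal _ hr]
  push_cast
  rfl

theorem toRealL0_smul {r : ℝ} (hr : 0 ≤ r) (a : L0Pos μ) :
    toRealL0 (r.toNNReal • a) = r • toRealL0 a := by
  refine AEEqFun.ext ?_
  filter_upwards [coeFn_toRealL0 a, coeFn_toRealL0 (r.toNNReal • a),
    AEEqFun.coeFn_smul r.toNNReal a, AEEqFun.coeFn_smul r (toRealL0 a)] with ω h1 h2 h3 h4
  rw [h2, h3, h4, Pi.smul_apply, Pi.smul_apply, h1, smul_eq_mul, smul_eq_mul, NNReal.coe_mul,
    Real.coe_toNNReal _ hr]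

theorem IsL0Seminorm.map_constL0_smul {p : E → L0Pos μ} (hp : IsL0Seminorm 𝕜 p) {r : ℝ}
    (hr : 0 ≤ r) (x : E) : p (constL0 𝕜 μ r • x) = r.toNNReal • p x := by
  rw [hp.smul]
  refine AEEqFun.ext ?_
  filter_upwards [AEEqFun.coeFn_mul (modulus (constL0 𝕜 μ r)) (p x),
    AEEqFun.coeFn_smul r.toNNReal (p x), coeFn_modulus (constL0 𝕜 μ r),
    coeFn_constL0 (𝕜 := 𝕜) (μ := μ) r] with ω h1 h2 h3 h4
  rw [h1, h2, Pi.mul_apply, Pi.smul_apply, h3, h4, smul_eq_mul]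
  congr 1
  rw [← NNReal.coe_inj, coe_nnnorm, RCLike.norm_ofReal, abs_of_nonneg hr, Real.coe_toNNReal _ hr]

/-- In an `L⁰`-convex set, `t B + t' B ⊆ (t + t') B`. -/
theorem IsL0Convex.exists_add_smul_eq {B : Set E} (hB : IsL0Convex 𝕜 μ B) {b b' : E}
    (hb : b ∈ B) (hb' : b' ∈ B) (t t' : L0Pos μ) :
    ∃ a ∈ B, toL0 𝕜 (t + t') • a = toL0 𝕜 t • b + toL0 𝕜 t' • b' := by
  have hm : Measurable fun ω => t ω / (t ω + t' ω) :=
    t.measurable.div (t.measurable.add t'.measurable)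
  -- Where `t + t' = 0` the quotient is `0`, and `(t + t') ξ = t` still holds since `t = 0` there.
  let ξ : L0Pos μ := AEEqFun.mk _ hm.aestronglyMeasurable
  have hξ : ∀ᵐ ω ∂μ, ξ ω = t ω / (t ω + t' ω) := AEEqFun.coeFn_mk _ _
  have hξ1 : ξ ≤ 1 := by
    rw [← AEEqFun.coeFn_le]
    filter_upwards [hξ, AEEqFun.coeFn_one (α := Ω) (β := ℝ≥0) (μ := μ)] with ω h1 h2
    rw [h1, h2]
    exact div_le_one_of_le₀ (le_add_of_nonneg_right bot_le) bot_le
  have hmul : (t + t') * ξ = t := by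
    refine AEEqFun.ext ?_
    filter_upwards [hξ, AEEqFun.coeFn_mul (t + t') ξ, AEEqFun.coeFn_add t t'] with ω h1 h2 h3
    rw [h2, Pi.mul_apply, h3, h1, Pi.add_apply]
    rcases eq_or_ne (t ω + t' ω) 0 with h | h
    · rw [h, zero_mul, (add_eq_zero.1 h).1]
    · rw [mul_div_cancel₀ _ h]
  have hmul' : toL0 𝕜 (t + t') * (1 - toL0 𝕜 ξ) = toL0 𝕜 t' := by
    rw [mul_sub, mul_one, ← toL0_mul, hmul, toL0_add, add_sub_cancel_left]
  refine ⟨_, hB b hb b' hb' ξ hξ1, ?_⟩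
  rw [smul_add, smul_smul, smul_smul, ← toL0_mul, hmul, hmul']

/-- The values `t + s (x - t b)`, `t ∈ L⁰₊(F)`, `b ∈ B`, whose infimum is the infimal convolution
of an `L⁰`-seminorm `s` and the gauge of `B`. -/
def gaugeValues (s : E → L0Pos μ) (B : Set E) (x : E) : Set (Ω →ₘ[μ] ℝ) :=
  {w | ∃ (t : L0Pos μ) (b : E), b ∈ B ∧ w = toRealL0 (t + s (x - toL0 𝕜 t • b))}

/-- If `B` has the countable concatenation property and the essential infimum of `gaugeValues s B x`
is `< 1`, some member of `gaugeValues s B x` is `≤ 1`. -/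
theorem exists_add_le_one_of_isGLB [IsFiniteMeasure μ] {s : E → L0Pos μ} (hs : IsL0Seminorm 𝕜 s)
    {B : Set E} (hBne : B.Nonempty) (hB : HasCountableConcatenation 𝕜 μ B) {x : E}
    {g : Ω →ₘ[μ] ℝ} (hg : IsGLB (gaugeValues (𝕜 := 𝕜) s B x) g) (hg1 : ∀ᵐ ω ∂μ, g ω < 1) :
    ∃ t : L0Pos μ, ∃ b ∈ B, t + s (x - toL0 𝕜 t • b) ≤ 1 := by
  obtain ⟨b₀, hb₀⟩ := hBne
  obtain ⟨g', hg', u, hu, hug⟩ := exists_isGLB_and_seq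
    (S := gaugeValues (𝕜 := 𝕜) s B x) ⟨_, 0, b₀, hb₀, rfl⟩ ⟨g, hg.1⟩
  obtain rfl := hg'.unique hg
  choose t b hb hut using hu
  -- Since the infimum of the sequence is `< 1`, almost every `ω` lies in a set where some term is
  -- `≤ 1`. The pairs `(t n, b n)` are then glued along a partition.
  obtain ⟨A, hA, hAD⟩ := exists_isCountablePartition (μ := μ)
    (D := fun n => {ω | (t n + s (x - toL0 𝕜 (t n) • b n)) ω ≤ 1})
    (fun n => measurableSet_le (AEEqFun.measurable _) measurable_const) (by
      filter_upwards [hug, hg1, ae_all_iff.2 fun n =>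
        coeFn_toRealL0 (t n + s (x - toL0 𝕜 (t n) • b n))] with ω h1 h2 h3
      obtain ⟨_, ⟨n, rfl⟩, -, hn⟩ := h1.exists_between h2
      refine ⟨n, ?_⟩
      simp only [hut, h3] at hn
      exact_mod_cast hn.le)
  obtain ⟨t', ht'⟩ := exists_concatenation_L0Pos (μ := μ) hA t
  obtain ⟨b', hb', hbb⟩ := hB A hA b hb
  have hloc : ∀ n, ∀ᵐ ω ∂μ, ω ∈ A n →
      s (x - toL0 𝕜 t' • b') ω = s (x - toL0 𝕜 (t n) • b n) ω := fun n => by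
    refine hs.eq_on_of_indicatorL0_smul_eq (hA.measurableSet n) ?_
    have ht : indicatorL0 𝕜 μ (A n) (hA.measurableSet n) * toL0 𝕜 t' =
        indicatorL0 𝕜 μ (A n) (hA.measurableSet n) * toL0 𝕜 (t n) := by
      refine AEEqFun.ext ?_
      filter_upwards [ht', coeFn_indicatorL0 (𝕜 := 𝕜) (μ := μ) (hA.measurableSet n),
        coeFn_toL0 (𝕜 := 𝕜) t', coeFn_toL0 (𝕜 := 𝕜) (t n),
        AEEqFun.coeFn_mul (indicatorL0 𝕜 μ (A n) (hA.measurableSet n)) (toL0 𝕜 t'),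
        AEEqFun.coeFn_mul (indicatorL0 𝕜 μ (A n) (hA.measurableSet n)) (toL0 𝕜 (t n))]
        with ω h1 h2 h3 h4 h5 h6
      rw [h5, h6, Pi.mul_apply, Pi.mul_apply, h2, h3, h4]
      by_cases hω : ω ∈ A n
      · rw [h1 n hω]
      · simp [hω]
    rw [smul_sub, smul_sub, smul_smul, smul_smul, ht, mul_comm, mul_smul, mul_smul, hbb n]
  refine ⟨t', b', hb', ?_⟩
  rw [← AEEqFun.coeFn_le]
  filter_upwards [hAD, ht', ae_all_iff.2 hloc, AEEqFun.coeFn_add t' (s (x - toL0 𝕜 t' • b')),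
    ae_all_iff.2 fun n => AEEqFun.coeFn_add (t n) (s (x - toL0 𝕜 (t n) • b n)),
    AEEqFun.coeFn_one (α := Ω) (β := ℝ≥0) (μ := μ)] with ω h1 h2 h3 h4 h5 h6
  obtain ⟨n, hn⟩ := mem_iUnion.1 (hA.iUnion_eq ▸ mem_univ ω)
  have h7 := h1 n hn
  rw [h5 n, Pi.add_apply] at h7
  rw [h4, h6, Pi.add_apply, h2 n hn, h3 n hn]
  exact h7

/-- Separation of a point from an `L⁰`-convex `L⁰`-balanced set `B` with the countable
concatenation property, with respect to an `L⁰`-seminorm. -/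
theorem exists_linearMap_separating [IsFiniteMeasure μ] {s : E → L0Pos μ}
    (hs : IsL0Seminorm 𝕜 s) {B : Set E} (hBne : B.Nonempty) (hbal : IsL0Balanced 𝕜 μ B)
    (hconv : IsL0Convex 𝕜 μ B) (hcc : HasCountableConcatenation 𝕜 μ B) {x₀ : E}
    (hx₀ : ∀ b ∈ B, ¬ s (x₀ - b) ≤ 1) :
    ∃ g : E →ₗ[L0 𝕜 μ] L0 𝕜 μ, (∀ x, modulus (g x) ≤ s x) ∧ (∀ b ∈ B, modulus (g b) ≤ 1) ∧
      ¬ modulus (g x₀) ≤ AEEqFun.const Ω (1 / 2 : ℝ≥0) := by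
  have hex : ∀ x, ∃ g, IsGLB (gaugeValues (𝕜 := 𝕜) s B x) g := fun x => by
    obtain ⟨b, hb⟩ := hBne
    refine (exists_isGLB_and_seq (S := gaugeValues (𝕜 := 𝕜) s B x) ⟨_, 0, b, hb, rfl⟩
      ⟨0, ?_⟩).imp fun _ h => h.1
    rintro _ ⟨t, b, -, rfl⟩
    exact toRealL0_nonneg _
  choose p hp using hex
  have hple : ∀ x (t : L0Pos μ), ∀ b ∈ B, p x ≤ toRealL0 (t + s (x - toL0 𝕜 t • b)) :=
    fun x t b hb => (hp x).1 ⟨t, b, hb, rfl⟩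
  have hadd : ∀ x y, p (x + y) ≤ p x + p y := fun x y => by
    refine le_add_of_isGLB (hp x) (hp y) ?_
    rintro _ ⟨t, b, hb, rfl⟩ _ ⟨t', b', hb', rfl⟩
    obtain ⟨a, ha, hab⟩ := hconv.exists_add_smul_eq hb hb' t t'
    refine (hple _ (t + t') a ha).trans ?_
    rw [← toRealL0_add, hab, add_sub_add_comm]
    refine toRealL0_mono ?_
    rw [add_add_add_comm t (s _)]
    exact add_le_add_L0Pos le_rfl (hs.add_le _ _)
  have hsmul : ∀ r : ℝ, 0 < r → ∀ x, p (constL0 𝕜 μ r • x) ≤ r • p x := fun r hr x => by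
    have h : r⁻¹ • p (constL0 𝕜 μ r • x) ≤ p x := by
      refine (hp x).2 ?_
      rintro _ ⟨t, b, hb, rfl⟩
      have := hple (constL0 𝕜 μ r • x) (r.toNNReal • t) b hb
      rw [toL0_smul hr.le, mul_smul, ← smul_sub, hs.map_constL0_smul hr.le, ← smul_add,
        toRealL0_smul hr.le] at this
      have := smul_le_smul_of_nonneg_left this (inv_pos.2 hr).le
      rwa [smul_smul r⁻¹ r, inv_mul_cancel₀ hr.ne', one_smul] at this
    have := smul_le_smul_of_nonneg_left h hr.le
    rwa [smul_smul, mul_inv_cancel₀ hr.ne', one_smul] at this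
  have hps : ∀ x, p x ≤ toRealL0 (s x) := fun x => by
    obtain ⟨b, hb⟩ := hBne
    have h0 : toL0 𝕜 (0 : L0Pos μ) = 0 := by
      have := toL0_add (𝕜 := 𝕜) (0 : L0Pos μ) 0
      rwa [add_zero, left_eq_add] at this
    simpa [h0] using hple x 0 b hb
  have hpB : ∀ b ∈ B, p b ≤ toRealL0 1 := fun b hb => by
    simpa [toL0_one, hs.map_zero] using hple b 1 b hb
  obtain ⟨g, hgp, hg₀, hgs⟩ := exists_linearMap_re_le hs hadd hsmul hps x₀
  refine ⟨g, hgs, fun b hb => ?_, fun h => ?_⟩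
  · obtain ⟨η, hη, hηg⟩ := exists_mul_eq_norm (g b)
    have h := hgp (η • b)
    rw [map_smul, smul_eq_mul] at h
    rw [modulus_le_one_iff]
    filter_upwards [h, hηg, AEEqFun.coeFn_mul η (g b), coeFn_toRealL0 (1 : L0Pos μ),
      AEEqFun.coeFn_le.2 (hpB _ (hbal η hη b hb)),
      AEEqFun.coeFn_one (α := Ω) (β := ℝ≥0) (μ := μ)] with ω h1 h2 h3 h4 h5 h6
    rw [h3, Pi.mul_apply, h2, RCLike.ofReal_re] at h1
    rw [h4, h6] at h5
    exact h1.trans h5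
  -- The constant `1/2` supplies the strict gap: `|g x₀| ≤ 1/2` forces `p x₀ < 1` almost surely,
  -- which gluing requires.
  · obtain ⟨t, b, hb, htb⟩ := exists_add_le_one_of_isGLB hs hBne hcc (hp x₀) (by
      filter_upwards [hg₀, AEEqFun.coeFn_le.2 h, coeFn_modulus (g x₀),
        AEEqFun.coeFn_const Ω (μ := μ) (1 / 2 : ℝ≥0)] with ω h1 h2 h3 h4
      rw [h3, h4, Function.const_apply, ← NNReal.coe_le_coe, coe_nnnorm] at h2
      rw [← h1]
      refine ((RCLike.re_le_norm _).trans h2).trans_lt ?_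
      norm_num)
    have hle : t ≤ 1 ∧ s (x₀ - toL0 𝕜 t • b) ≤ 1 := by
      simp only [← AEEqFun.coeFn_le] at *
      constructor <;> filter_upwards [htb, AEEqFun.coeFn_add t (s (x₀ - toL0 𝕜 t • b))]
        with ω h1 h2 <;> rw [h2, Pi.add_apply] at h1
      · exact (le_add_of_nonneg_right bot_le).trans h1
      · exact (le_add_of_nonneg_left bot_le).trans h1
    exact hx₀ _ (hbal _ ((modulus_toL0 t).trans_le hle.1) b hb) hle.2

end Separation

/-! ### Pre-barreled modules -/

section PreBarreled

variable {𝕜 : Type*} [RCLike 𝕜] {Ω : Type*} [MeasurableSpace Ω] {μ : Measure Ω}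
  [IsFiniteMeasure μ] {E : Type*} [AddCommGroup E] [Module (L0 𝕜 μ) E] {P : Set (E → L0Pos μ)}

/-- Every defining `L⁰`-seminorm is the polar seminorm of a weakly bounded set. -/
theorem exists_polarSeminorm_eq (hP : ∀ p ∈ P, IsL0Seminorm 𝕜 p) {p : E → L0Pos μ} (hp : p ∈ P) :
    ∃ A, (∀ x, BddAbove ((fun a =>
        modulus (naturalPairing 𝕜 μ (locallyL0ConvexTopology P) x a)) '' A)) ∧
      polarSeminorm (naturalPairing 𝕜 μ (locallyL0ConvexTopology P)) A = p := by
  let A : Set (randomConjugate 𝕜 μ (locallyL0ConvexTopology P)) :=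
    {f | ∀ x, modulus (f.1 x) ≤ p x}
  have hA : ∀ x, BddAbove ((fun a =>
      modulus (naturalPairing 𝕜 μ (locallyL0ConvexTopology P) x a)) '' A) :=
    fun x => ⟨p x, forall_mem_image.2 fun f hf => hf x⟩
  refine ⟨A, hA, funext fun x => ((polarSeminorm_le_iff hA).2 fun f hf => hf x).antisymm ?_⟩
  -- The seminorm serves both as the sublinear map and as its own dominating seminorm.
  obtain ⟨g, -, hgx, hgp⟩ := exists_linearMap_re_le (hP p hp) (p := fun x => toRealL0 (p x))
    (fun x y => (toRealL0_mono ((hP p hp).add_le x y)).trans_eq (toRealL0_add _ _))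
    (fun r hr x => by rw [(hP p hp).map_constL0_smul hr.le, toRealL0_smul hr.le])
    (fun x => le_rfl) x
  have hg : g ∈ randomConjugate 𝕜 μ (locallyL0ConvexTopology P) :=
    mem_randomConjugate_of_modulus_le hP (Q := {p}) (c := 1) (by simpa using hp) fun y => by
      simpa [supSeminorm] using hgp y
  refine le_trans ?_ (modulus_le_polarSeminorm hA (a := ⟨g, hg⟩) hgp x)
  rw [← AEEqFun.coeFn_le]
  change ∀ᵐ ω ∂μ, p x ω ≤ modulus (g x) ω
  filter_upwards [hgx, coeFn_toRealL0 (p x), coeFn_modulus (g x)] with ω h1 h2 h3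
  rw [h3, ← NNReal.coe_le_coe, ← h2, ← h1]
  exact RCLike.re_le_norm _

/-- Balls of polar seminorms are closed. -/
theorem isClosed_polarSeminorm_ball {T : TopologicalSpace E} {A : Set (randomConjugate 𝕜 μ T)}
    (hA : ∀ x, BddAbove ((fun a => modulus (naturalPairing 𝕜 μ T x a)) '' A)) (ε : L0Pos μ) :
    IsClosed[T] {x | polarSeminorm (naturalPairing 𝕜 μ T) A x ≤ ε} := by
  refine isClosed_of_closure_subset fun x hx => (polarSeminorm_le_iff hA).2 fun f hf => ?_
  -- Compare `f x` with `f y` for a point `y` of the ball near `x`, with constant errors so that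
  -- only countably many null sets occur.
  have hn : ∀ n : ℕ, ∀ᵐ ω ∂μ, modulus (f.1 x) ω ≤ ε ω + 1 / ((n : ℝ≥0) + 1) := fun n => by
    have hδ : AEEqFun.const Ω (1 / ((n : ℝ≥0) + 1)) ∈ L0PosPos μ := by
      filter_upwards [AEEqFun.coeFn_const Ω (μ := μ) (1 / ((n : ℝ≥0) + 1))] with ω h
      rw [h]
      exact Nat.one_div_pos_of_nat
    obtain ⟨y, hy, hyε⟩ := mem_closure_iff_nhds.1 hx _
      ((continuous_scalar_iff T f.1).1 f.2 x _ hδ)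
    have hfy : modulus (f.1 y) ≤ ε := (polarSeminorm_le_iff hA).1 hyε f hf
    have h : modulus (f.1 x) ≤ ε + AEEqFun.const Ω (1 / ((n : ℝ≥0) + 1)) := by
      rw [show f.1 x = f.1 y + -(f.1 y - f.1 x) by abel]
      refine (modulus_add_le _ _).trans (add_le_add_L0Pos hfy ?_)
      rw [modulus_neg]
      exact hy
    filter_upwards [AEEqFun.coeFn_le.2 h, AEEqFun.coeFn_const Ω (μ := μ) (1 / ((n : ℝ≥0) + 1)),
      AEEqFun.coeFn_add ε (AEEqFun.const Ω (1 / ((n : ℝ≥0) + 1)))] with ω h1 h2 h3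
    rwa [h3, Pi.add_apply, h2] at h1
  change modulus (f.1 x) ≤ ε
  rw [← AEEqFun.coeFn_le]
  filter_upwards [ae_all_iff.2 hn] with ω h
  refine ge_of_tendsto' (x := atTop) (f := fun n : ℕ => ε ω + 1 / ((n : ℝ≥0) + 1)) ?_ h
  simpa using tendsto_const_nhds.add (tendsto_one_div_add_atTop_nhds_zero_nat (𝕜 := ℝ≥0))

/-- In a pre-barreled module the balls of the polar seminorms of weakly bounded sets are
neighborhoods of `0`. -/
theorem IsL0PreBarreled.polarSeminorm_ball_mem_nhds {T : TopologicalSpace E}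
    (hT : IsL0PreBarreled 𝕜 μ T) (hE : HasCountableConcatenation 𝕜 μ (univ : Set E))
    {A : Set (randomConjugate 𝕜 μ T)}
    (hA : ∀ x, BddAbove ((fun a => modulus (naturalPairing 𝕜 μ T x a)) '' A)) {ε : L0Pos μ}
    (hε : ε ∈ L0PosPos μ) :
    {x | polarSeminorm (naturalPairing 𝕜 μ T) A x ≤ ε} ∈ @nhds E T 0 :=
  have h := isL0Seminorm_polarSeminorm hA
  hT _ ⟨h.isL0Balanced_ball ε, h.isL0Absorbent_ball hε, h.isL0Convex_ball ε,
    isClosed_polarSeminorm_ball hA ε⟩ (h.hasCountableConcatenation_ball hE ε)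

/-- The bipolar theorem: an `L⁰`-barrel with the countable concatenation property contains a ball
of the polar seminorm of a weakly bounded set. -/
theorem IsL0Barrel.exists_polarSeminorm_ball_subset (hP : ∀ p ∈ P, IsL0Seminorm 𝕜 p) {B : Set E}
    (hB : IsL0Barrel 𝕜 μ (locallyL0ConvexTopology P) B) (hcc : HasCountableConcatenation 𝕜 μ B) :
    ∃ A, (∀ x, BddAbove ((fun a =>
        modulus (naturalPairing 𝕜 μ (locallyL0ConvexTopology P) x a)) '' A)) ∧
      {x | polarSeminorm (naturalPairing 𝕜 μ (locallyL0ConvexTopology P)) A x ≤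
        AEEqFun.const Ω (1 / 2 : ℝ≥0)} ⊆ B := by
  -- The polar of `B`.
  let A : Set (randomConjugate 𝕜 μ (locallyL0ConvexTopology P)) :=
    {f | ∀ b ∈ B, modulus (f.1 b) ≤ 1}
  have hA : ∀ x, BddAbove ((fun a =>
      modulus (naturalPairing 𝕜 μ (locallyL0ConvexTopology P) x a)) '' A) := fun x => by
    obtain ⟨ξ, hξ, hξB⟩ := hB.absorbent x
    obtain ⟨c, hc⟩ := exists_mul_eq_one hξ
    refine ⟨c, forall_mem_image.2 fun f hf => ?_⟩
    have := hf _ (hξB (toL0 𝕜 ξ) (modulus_toL0 ξ).le x rfl)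
    rw [map_smul, modulus_smul, modulus_toL0] at this
    refine (mul_le_one_iff_of_mul_eq_one ?_ _).1 this
    simpa only [mul_comm] using hc
  refine ⟨A, hA, fun x₀ hx₀ => by_contra fun hxB => ?_⟩
  have hmem : Bᶜ ∈ @nhds E (locallyL0ConvexTopology P) x₀ := by
    let _ := locallyL0ConvexTopology P
    exact hB.closed.isOpen_compl.mem_nhds hxB
  obtain ⟨Q, hQ, ε, hε, hQB⟩ := (mem_nhds_iff_supSeminorm hP x₀ _).1 hmem
  obtain ⟨c, hc⟩ := exists_mul_eq_one hε
  have hsup := isL0Seminorm_supSeminorm hP hQ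
  have hBne : B.Nonempty := by
    obtain ⟨ξ, -, hξB⟩ := hB.absorbent 0
    exact ⟨_, hξB 0 (modulus_zero.trans_le bot_le) 0 rfl⟩
  obtain ⟨g, hgs, hgB, hgx⟩ := exists_linearMap_separating (hsup.const_mul c) hBne hB.balanced
    hB.convex hcc (x₀ := x₀) fun b hb h => by
      rw [mul_le_one_iff_of_mul_eq_one hc, ← hsup.map_neg, neg_sub] at h
      exact hQB _ h (by simpa using hb)
  exact hgx (((modulus_le_polarSeminorm hA (a := ⟨g, mem_randomConjugate_of_modulus_le hP hQ hgs⟩)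
    hgB x₀)).trans hx₀)

end PreBarreled

end

end RandomConvex

open RandomConvex in
theorem theorem3p40 {𝕜 : Type*} [RCLike 𝕜] {Ω : Type*} [MeasurableSpace Ω]
    {μ : MeasureTheory.Measure Ω} [MeasureTheory.IsProbabilityMeasure μ]
    {E : Type*} [AddCommGroup E] [Module (RandomConvex.L0 𝕜 μ) E]
    (P : Set (E → RandomConvex.L0Pos μ)) (hP : RandomConvex.IsRLCModule 𝕜 P)
    (hE : RandomConvex.HasCountableConcatenation 𝕜 μ (Set.univ : Set E)) :
    RandomConvex.IsL0PreBarreled 𝕜 μ (RandomConvex.locallyL0ConvexTopology P) ↔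
      RandomConvex.locallyL0ConvexTopology P =
        RandomConvex.strongTopology
          (RandomConvex.naturalPairing 𝕜 μ (RandomConvex.locallyL0ConvexTopology P)) := by
  constructor
  · intro h
    refine le_antisymm (locallyL0ConvexTopology_le hP.seminorm ?_)
      -- Needs no barrels: `P` is contained in the family defining `β`.
      (locallyL0ConvexTopology_anti fun p hp => ?_)
    · rintro _ ⟨A, hA, rfl⟩ ε hε
      exact h.polarSeminorm_ball_mem_nhds hE (isL0Bounded_weakTopology_flip_iff.1 hA) hε
    · obtain ⟨A, hA, rfl⟩ := exists_polarSeminorm_eq hP.seminorm hp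
      exact ⟨A, isL0Bounded_weakTopology_flip_iff.2 hA, rfl⟩
  · intro h B hB hcc
    obtain ⟨A, hA, hAB⟩ := hB.exists_polarSeminorm_ball_subset hP.seminorm hcc
    refine Filter.mem_of_superset ?_ hAB
    have hmem := ball_mem_nhds (𝕜 := 𝕜) (P := polarSeminorm (naturalPairing 𝕜 μ
        (locallyL0ConvexTopology P)) '' {A | IsL0Bounded 𝕜 μ (weakTopology (naturalPairing 𝕜 μ
        (locallyL0ConvexTopology P)).flip) A})
      (by
        rintro _ ⟨A, hA, rfl⟩
        exact isL0Seminorm_polarSeminorm (isL0Bounded_weakTopology_flip_iff.1 hA))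
      ⟨A, isL0Bounded_weakTopology_flip_iff.2 hA, rfl⟩ (ε := AEEqFun.const Ω (1 / 2 : ℝ≥0)) (by
        filter_upwards [AEEqFun.coeFn_const Ω (μ := μ) (1 / 2 : ℝ≥0)] with ω h
        rw [h]
        exact one_half_pos)
    exact (congrArg (fun T => _ ∈ @nhds E T 0) h).mpr hmem
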